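/- Consider three point masses in the plane $\mathbb{R}^2$ with equal masses $m_1=m_2=m_3>0$, positions $q_1,q_2,q_3$ and momenta $p_1,p_2,p_3$, moving under Newtonian gravitation, $$m_k\frac{dq_k}{dt}=p_k,\qquad \frac{dp_k}{dt}=\sum_{j\neq k}\frac{m_jm_k}{|q_j-q_k|^{3}}(q_j-q_k),$$ with centre of mass fixed at the origin, $\sum_k m_kq_k=0$. Put $$U=\sum_{j<k}\frac{m_jm_k}{|q_j-q_k|},\qquad I=\sum_k m_k|q_k|^2,\qquad H=\frac12\sum_k\frac{|p_k|^2}{m_k}-U .$$ Let $(q,p)$ be a collision-free solution on a nonempty open time interval $J$ (not necessarily maximal) whose energy satisfies $H\ge 0$ and whose configurational measure $U I^{1/2}$ is constant on $J$. Then the solution is homographic: there is $t_0\in J$ such that for every $t\in J$ there exist a scalar $R(t)>0$ and an orthogonal matrix $\Omega(t)$ with $$q_k(t)=R(t)\,\Omega(t)\,q_k(t_0)\qquad (k=1,2,3).$$ -/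

import Mathlib

noncomputable section

/-- The Euclidean plane. -/
abbrev Plane : Type := EuclideanSpace ℝ (Fin 2)

/-- The Newtonian potential function `U = ∑_{j<k} m_j m_k / |q_j - q_k|`. -/
def potential {n : ℕ} (m : Fin n → ℝ) (x : Fin n → Plane) : ℝ :=
  ∑ j, ∑ k ∈ Finset.Ioi j, m j * m k / ‖x j - x k‖

/-- The moment of inertia `I = ∑ m_k |q_k|²` about the origin. -/
def momentOfInertia {n : ℕ} (m : Fin n → ℝ) (x : Fin n → Plane) : ℝ :=
  ∑ k, m k * ‖x k‖ ^ 2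

/-- The configurational measure `U I^{1/2}` of the Newtonian problem. -/
def configMeasure {n : ℕ} (m : Fin n → ℝ) (x : Fin n → Plane) : ℝ :=
  potential m x * Real.sqrt (momentOfInertia m x)

/-- The total energy `H = T - U`, where `T = (1/2) ∑ |p_k|² / m_k`. -/
def energy {n : ℕ} (m : Fin n → ℝ) (x y : Fin n → Plane) : ℝ :=
  (1 / 2) * ∑ k, ‖y k‖ ^ 2 / m k - potential m x

/-- The force `∑_{j ≠ k} (m_j m_k / |q_j - q_k|³) (q_j - q_k)` on the `k`-th body. -/
def force {n : ℕ} (m : Fin n → ℝ) (x : Fin n → Plane) (k : Fin n) : Plane :=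
  ∑ j ∈ Finset.univ.erase k, (m j * m k / ‖x j - x k‖ ^ 3) • (x j - x k)

/-- `(q, p)` is a solution of the planar Newtonian `n`-body problem with masses `m` on the
nonempty open interval `J` (not necessarily maximal), with centre of mass fixed at the origin. -/
structure IsSolution {n : ℕ} (m : Fin n → ℝ) (J : Set ℝ) (q p : ℝ → Fin n → Plane) : Prop where
  isOpen : IsOpen J
  ordConnected : J.OrdConnected
  nonempty : J.Nonempty
  /-- The solution runs in the domain of the vector field: no two bodies coincide. -/
  noCollision : ∀ t ∈ J, Function.Injective (q t)
  hasDerivAt_q : ∀ t ∈ J, ∀ k, HasDerivAt (fun s => q s k) ((m k)⁻¹ • p t k) t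
  hasDerivAt_p : ∀ t ∈ J, ∀ k, HasDerivAt (fun s => p s k) (force m (q t) k) t
  centreOfMass : ∀ t ∈ J, ∑ k, m k • q t k = 0

/-- The motion `q` is homographic on `J`: for some fixed `t₀` in `J` there are, for every `t` in
`J`, a scalar `R(t) > 0` and an orthogonal transformation `Ω(t)` of the plane such that
`q_k(t) = R(t) Ω(t) q_k(t₀)` for all `k`. -/
def IsHomographic {n : ℕ} (J : Set ℝ) (q : ℝ → Fin n → Plane) : Prop :=
  ∃ t₀ ∈ J, ∃ (R : ℝ → ℝ) (Ω : ℝ → (Plane ≃ₗᵢ[ℝ] Plane)),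
    ∀ t ∈ J, 0 < R t ∧ ∀ k, q t k = R t • Ω t (q t₀ k)

end

/-! ### Polynomial rigidity for algebraic solutions of a first order differential equation. -/

noncomputable section
open Polynomial

/-! Divide the sides of the triangle by R, the square root of the moment of inertia for unit masses.
On a level line of the measure, the normalized perimeter s determines the elementary symmetric
functions of the normalized sides. Hence the squared gradient Γ of the measure, its second
derivative Θ along the level line and the squared perimeter speed are rational in s, with poles only
at s² = 3 (`exists_shape_polynomials`).

Constancy of the measure acts three times. The potential is a constant over R, so the
Lagrange-Jacobi identity integrates once (`exists_integrals`). The velocity splits into a dilation,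
a rotation and a shape velocity of speed σ along the level line (`velocity_decomposition`), and
comparison with the integrals shows that K = σ²Γ is constant. The second derivative of the measure
gives mRΓ + 2CσΓ + σ²Θ = 0 (`level_curvature_equation`), which makes R an algebraic function of s
with one square root. The integral for the dilation then becomes a first order differential equation
for R in the variable s (`size_ode`).

If s were not constant, that equation would hold at infinitely many s, hence identically, and could
be read at s = √3, which the motion never reaches. There the algebraic function S = -mRN², where N
is the numerator of Γ, vanishes. The equation equates a nonzero multiple of the square of S'N - 2SN'
with a multiple of S², so S vanishes identically (`algebraic_ode_trivial`), contradicting R > 0.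
Thus s is constant. The normalized sides are roots of a fixed cubic, so they are constant by
connectedness, and triangles with proportional sides are similar. -/

/-- If `P² = Q² L` and `L` has a simple root, then `P = 0`. -/
theorem eq_zero_of_sq_eq_sq_mul {P Q L : ℝ[X]} {a : ℝ} (h : P ^ 2 = Q ^ 2 * L)
    (h0 : L.eval a = 0) (h1 : L.derivative.eval a ≠ 0) : P = 0 := by
  by_contra hP
  have hL : L ≠ 0 := by rintro rfl; simp at h1
  have hQ : Q ≠ 0 := by
    rintro rfl
    simp at h
    exact hP h
  have hm : L.rootMultiplicity a = 1 := by
    have h2 : 0 < L.rootMultiplicity a := (rootMultiplicity_pos hL).2 h0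
    have h3 : ¬ 1 < L.rootMultiplicity a := by
      rw [one_lt_rootMultiplicity_iff_isRoot hL]
      exact fun h => h1 h.2
    omega
  -- Parity: the multiplicity at `a` is even on the left and odd on the right.
  have h4 := congrArg (rootMultiplicity a) h
  rw [rootMultiplicity_mul (mul_ne_zero (pow_ne_zero _ hQ) hL), pow_two, pow_two,
    rootMultiplicity_mul (mul_ne_zero hP hP), rootMultiplicity_mul (mul_ne_zero hQ hQ), hm] at h4
  omega

/-- A nonzero polynomial `B` vanishing at `a` cannot divide its logarithmic derivative away. -/
theorem eq_zero_of_logDeriv {B N K G : ℝ[X]} {a : ℝ} (hB : B.eval a = 0)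
    (hN : N.eval a ≠ 0) (hK : K.eval a ≠ 0)
    (h : K * (derivative B * N - 2 * B * derivative N) ^ 2 = B ^ 2 * G) : B = 0 := by
  by_contra hB0
  obtain ⟨b, hb, hb'⟩ := exists_eq_pow_rootMultiplicity_mul_and_not_dvd B hB0 a
  have hr : 0 < B.rootMultiplicity a := (rootMultiplicity_pos hB0).2 hB
  obtain ⟨n, hn⟩ : ∃ n, B.rootMultiplicity a = n + 1 := ⟨_, (Nat.succ_pred_eq_of_pos hr).symm⟩
  rw [hn] at hb
  rw [dvd_iff_isRoot, IsRoot.def] at hb'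
  -- With B = (X - a)^(n+1) b, differentiation loses one power, so the left side of `h` has order
  -- exactly 2n at `a` and the right side at least 2n + 2.
  have hd : derivative B = (X - C a) ^ n * ((n + 1 : ℝ[X]) * b + (X - C a) * derivative b) := by
    rw [hb, derivative_mul, derivative_pow]
    simp
    ring
  have h2 : (X - C a) ^ (2 * n) *
      (K * (((n + 1 : ℝ[X]) * b + (X - C a) * derivative b) * N
        - 2 * ((X - C a) * b) * derivative N) ^ 2)
      = (X - C a) ^ (2 * n) * ((X - C a) ^ 2 * b ^ 2 * G) := by
    rw [hd] at h
    rw [hb] at h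
    linear_combination h
  have h3 := mul_left_cancel₀ (pow_ne_zero _ (X_sub_C_ne_zero a)) h2
  have h4 := congrArg (eval a) h3
  simp at h4
  rcases h4 with h4 | h4
  · exact hK h4
  · rcases h4 with h4 | h4
    · rcases h4 with h4 | h4
      · have : (n : ℝ) + 1 ≠ 0 := by positivity
        exact this h4
      · exact hb' h4
    · exact hN h4

/-- An algebraic function `S = 2DNη + B`, `η² = αDN`, vanishing at a simple zero `a` of `D`
and satisfying a first order differential equation that is regular there, is zero. -/
theorem algebraic_ode_trivial {D N δ B : ℝ[X]} {a α k h g c : ℝ} (hD : D.eval a = 0)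
    (hD' : (derivative D).eval a ≠ 0) (hN : N.eval a ≠ 0) (hδ : δ.eval a ≠ 0)
    (hB : B.eval a = 0) (hk : k ≠ 0) {Z : Set ℝ} (hZ : Z.Infinite)
    (H : ∀ s ∈ Z, ∃ η : ℝ, η ^ 2 = α * (D.eval s * N.eval s) ∧
      k * δ.eval s * N.eval s * ((N.eval s * (3 * (derivative D).eval s * N.eval s
          - D.eval s * (derivative N).eval s)) * η
          + ((derivative B).eval s * N.eval s - 2 * B.eval s * (derivative N).eval s)) ^ 2
        = (2 * D.eval s * N.eval s * η + B.eval s) ^ 2 *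
          (h * (2 * D.eval s * N.eval s * η + B.eval s) ^ 2
            + g * N.eval s ^ 2 * (2 * D.eval s * N.eval s * η + B.eval s)
            + c * N.eval s ^ 4)) :
    α = 0 ∧ B = 0 := by
  set u : ℝ[X] := 2 * D * N with hu
  set v : ℝ[X] := N * (3 * derivative D * N - D * derivative N) with hv
  set E : ℝ[X] := derivative B * N - 2 * B * derivative N with hE
  set L : ℝ[X] := C α * (D * N) with hL
  -- After η² is replaced by `L`, the equation reads P + Qη = 0. Multiplication by P - Qη removes
  -- the square root.
  set P : ℝ[X] := C k * δ * N * (v ^ 2 * L + E ^ 2)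
    - (C h * (B ^ 4 + 6 * B ^ 2 * u ^ 2 * L + u ^ 4 * L ^ 2)
      + C g * N ^ 2 * (B ^ 3 + 3 * B * u ^ 2 * L) + C c * N ^ 4 * (B ^ 2 + u ^ 2 * L)) with hP
  set Q : ℝ[X] := C k * δ * N * (2 * v * E)
    - (C h * (4 * B ^ 3 * u + 4 * B * u ^ 3 * L)
      + C g * N ^ 2 * (3 * B ^ 2 * u + u ^ 3 * L) + C c * N ^ 4 * (2 * u * B)) with hQ
  have hPQ : P ^ 2 = Q ^ 2 * L := by
    refine eq_of_infinite_eval_eq _ _ (hZ.mono fun s hs => ?_)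
    obtain ⟨η, h1, h2⟩ := H s hs
    have h3 : P.eval s + Q.eval s * η = 0 := by
      have e1 : L.eval s = η ^ 2 := by simp [hL, h1]
      simp only [hP, hQ, eval_sub, eval_add, eval_mul, eval_pow, eval_C, eval_ofNat, e1]
      simp only [hu, hv, hE, eval_sub, eval_mul, eval_ofNat]
      linear_combination h2
    have e1 : L.eval s = η ^ 2 := by simp [hL, h1]
    change (P ^ 2).eval s = (Q ^ 2 * L).eval s
    simp only [eval_mul, eval_pow, e1]
    linear_combination (P.eval s - Q.eval s * η) * h3
  have hP0 : P = 0 := by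
    by_cases hα : α = 0
    · have : P ^ 2 = 0 := by rw [hPQ, hL, hα]; simp
      exact pow_eq_zero_iff (two_ne_zero) |>.1 this
    · refine eq_zero_of_sq_eq_sq_mul (a := a) hPQ (by simp [hL, hD]) ?_
      simp [hL, hD, hα, hD', hN]
  -- The value of `P` at `a` forces B'(a) = 0. In the derivative of `P` at `a` only kδNv²L' then
  -- survives, and it is a nonzero multiple of α.
  have hα : α = 0 := by
    have h1 := congrArg (eval a) hP0
    have h2 := congrArg (fun p => eval a (derivative p)) hP0
    have hB' : (derivative B).eval a = 0 := by
      simpa [hP, hL, hE, hu, hD, hB, hk, hδ, hN] using h1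
    simpa [hP, hL, hE, hu, hv, hD, hB, hB', hk, hδ, hN, hD', derivative_pow] using h2
  refine ⟨hα, eq_zero_of_logDeriv (K := C k * δ * N)
    (G := C h * B ^ 2 + C g * N ^ 2 * B + C c * N ^ 4) hB hN (by simp [hk, hδ, hN]) ?_⟩
  have : L = 0 := by simp [hL, hα]
  rw [hP, this] at hP0
  rw [hE] at hP0
  linear_combination hP0

end

/-! ### Geometry of the shape sphere and of the level lines of the measure. -/

noncomputable section
open ComplexConjugate

/-- The power sum `y₁ⁿ + y₂ⁿ + y₃ⁿ`. -/
def powSum (n : ℕ) (y₁ y₂ y₃ : ℝ) : ℝ := y₁ ^ n + y₂ ^ n + y₃ ^ n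

/-- The squared length of the gradient of the configurational measure on the shape sphere,
in terms of the inverse normalized distances. -/
def gradSq (y₁ y₂ y₃ : ℝ) : ℝ :=
  3 / 2 * powSum 6 y₁ y₂ y₃ - 3 / 2 * powSum 3 y₁ y₂ y₃ ^ 2
    + 2 * powSum 1 y₁ y₂ y₃ * powSum 3 y₁ y₂ y₃ - powSum 1 y₁ y₂ y₃ ^ 2

/-- The second derivative of the configurational measure along its level line (times the squared
gradient), where `W` is the square of twice the area of the normalized triangle. -/
def levelHess (W y₁ y₂ y₃ : ℝ) : ℝ :=
  2 * W * (2 * powSum 5 y₁ y₂ y₃ * powSum 6 y₁ y₂ y₃ - 3 * powSum 11 y₁ y₂ y₃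
      - powSum 3 y₁ y₂ y₃ ^ 2 * powSum 5 y₁ y₂ y₃
      + 2 * powSum 3 y₁ y₂ y₃ * powSum 8 y₁ y₂ y₃)
    - ((powSum 1 y₁ y₂ y₃ - powSum 3 y₁ y₂ y₃) ^ 2 * powSum 1 y₁ y₂ y₃
      + (3 / 2 * powSum 3 y₁ y₂ y₃ - powSum 1 y₁ y₂ y₃) ^ 2 * powSum 5 y₁ y₂ y₃
      + 9 / 4 * powSum 11 y₁ y₂ y₃
      + 2 * (powSum 1 y₁ y₂ y₃ - powSum 3 y₁ y₂ y₃)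
        * (3 / 2 * powSum 3 y₁ y₂ y₃ - powSum 1 y₁ y₂ y₃) * powSum 3 y₁ y₂ y₃
      - 3 * (powSum 1 y₁ y₂ y₃ - powSum 3 y₁ y₂ y₃) * powSum 6 y₁ y₂ y₃
      - 3 * (3 / 2 * powSum 3 y₁ y₂ y₃ - powSum 1 y₁ y₂ y₃) * powSum 8 y₁ y₂ y₃)
    + powSum 1 y₁ y₂ y₃ * gradSq y₁ y₂ y₃

/-- Triples with zero sum form a plane, and this is the expansion of `e` in the orthogonal basis
`d`, `Y`, with denominators cleared. The primed variables stand for complex conjugates, kept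
independent so that the identity is purely polynomial. -/
theorem gram_expansion {R : Type*} [CommRing R]
    {d₁ d₂ d₃ d₁' d₂' d₃' Y₁ Y₂ Y₃ Y₁' Y₂' Y₃' e₁ e₂ e₃ : R}
    (hd : d₁ + d₂ + d₃ = 0) (hd' : d₁' + d₂' + d₃' = 0)
    (hY : Y₁ + Y₂ + Y₃ = 0) (hY' : Y₁' + Y₂' + Y₃' = 0) (he : e₁ + e₂ + e₃ = 0)
    (h : d₁' * Y₁ + d₂' * Y₂ + d₃' * Y₃ = 0) (h' : Y₁' * d₁ + Y₂' * d₂ + Y₃' * d₃ = 0) :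
    (d₁' * d₁ + d₂' * d₂ + d₃' * d₃) * (Y₁' * Y₁ + Y₂' * Y₂ + Y₃' * Y₃) * e₁
      = (Y₁' * Y₁ + Y₂' * Y₂ + Y₃' * Y₃) * (d₁' * e₁ + d₂' * e₂ + d₃' * e₃) * d₁
        + (d₁' * d₁ + d₂' * d₂ + d₃' * d₃) * (Y₁' * e₁ + Y₂' * e₂ + Y₃' * e₃) * Y₁ := by
  obtain rfl : d₃ = -d₁ - d₂ := by linear_combination hd
  obtain rfl : d₃' = -d₁' - d₂' := by linear_combination hd'
  obtain rfl : Y₃ = -Y₁ - Y₂ := by linear_combination hY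
  obtain rfl : Y₃' = -Y₁' - Y₂' := by linear_combination hY'
  obtain rfl : e₃ = -e₁ - e₂ := by linear_combination he
  linear_combination ((Y₁' * d₁ + Y₂' * d₂ + (-Y₁' - Y₂') * (-d₁ - d₂)) * e₁
    - (Y₁' * e₁ + Y₂' * e₂ + (-Y₁' - Y₂') * (-e₁ - e₂)) * d₁) * h
    - (d₁' * e₁ + d₂' * e₂ + (-d₁' - d₂') * (-e₁ - e₂)) * Y₁ * h'

/-- The force on a side of the normalized triangle, paired with that side. -/
def virial (x y₁ y₂ y₃ : ℝ) : ℝ :=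
  3 / 2 * powSum 3 y₁ y₂ y₃ - powSum 1 y₁ y₂ y₃ - powSum 3 y₁ y₂ y₃ * x ^ 2 - 3 / 2 * x⁻¹ ^ 3

/-- The real part of the pairing of the gradient of the measure with a side. -/
def gradPair (x y₁ y₂ y₃ : ℝ) : ℝ := virial x y₁ y₂ y₃ + powSum 1 y₁ y₂ y₃ * x ^ 2

/-- The vector paired with the side is the normalized Newtonian acceleration with its dilation part
removed, that is, the gradient of the measure. -/
theorem conj_mul_grad {x₁ x₂ x₃ y₁ y₂ y₃ : ℝ} {d₁ d₂ d₃ d₁' : ℂ} {w : ℝ}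
    (hxy₁ : x₁ * y₁ = 1) (hxy₂ : x₂ * y₂ = 1) (hxy₃ : x₃ * y₃ = 1)
    (hx : x₁ ^ 2 + x₂ ^ 2 + x₃ ^ 2 = 3)
    (h₁ : d₁' * d₁ = x₁ ^ 2)
    (h₂ : d₁' * d₂ = (x₃ ^ 2 - x₁ ^ 2 - x₂ ^ 2) / 2 + Complex.I * w)
    (h₃ : d₁' * d₃ = (x₂ ^ 2 - x₁ ^ 2 - x₃ ^ 2) / 2 - Complex.I * w) :
    d₁' * ((powSum 1 y₁ y₂ y₃ - 3 * y₁ ^ 3) * d₁ + (y₁ ^ 3 * d₁ + y₂ ^ 3 * d₂ + y₃ ^ 3 * d₃))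
      = gradPair x₁ y₁ y₂ y₃ + Complex.I * w * (y₂ ^ 3 - y₃ ^ 3) := by
  have hi : x₁⁻¹ = y₁ := inv_eq_of_mul_eq_one_right hxy₁
  have k₁ : (x₁ : ℂ) * y₁ = 1 := by exact_mod_cast hxy₁
  have k₂ : (x₂ : ℂ) * y₂ = 1 := by exact_mod_cast hxy₂
  have k₃ : (x₃ : ℂ) * y₃ = 1 := by exact_mod_cast hxy₃
  have k : (x₁ : ℂ) ^ 2 + x₂ ^ 2 + x₃ ^ 2 = 3 := by exact_mod_cast hx
  have m₁ : (x₁ : ℂ) ^ 2 * y₁ ^ 3 = y₁ := by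
    linear_combination (x₁ * y₁ ^ 2 + y₁) * k₁
  have m₂ : (x₂ : ℂ) ^ 2 * y₂ ^ 3 = y₂ := by
    linear_combination (x₂ * y₂ ^ 2 + y₂) * k₂
  have m₃ : (x₃ : ℂ) ^ 2 * y₃ ^ 3 = y₃ := by
    linear_combination (x₃ * y₃ ^ 2 + y₃) * k₃
  simp only [gradPair, virial, powSum, hi]
  push_cast
  linear_combination ((y₁ : ℂ) + y₂ + y₃ - 2 * y₁ ^ 3) * h₁ + (y₂ : ℂ) ^ 3 * h₂
    + (y₃ : ℂ) ^ 3 * h₃ - m₁ - m₂ - m₃ + (y₂ ^ 3 + y₃ ^ 3 : ℂ) / 2 * k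

theorem powSum_rotate (n : ℕ) (y₁ y₂ y₃ : ℝ) : powSum n y₂ y₃ y₁ = powSum n y₁ y₂ y₃ := by
  simp only [powSum]
  ring

theorem gradPair_rotate (x y₁ y₂ y₃ : ℝ) : gradPair x y₂ y₃ y₁ = gradPair x y₁ y₂ y₃ := by
  simp only [gradPair, virial, powSum_rotate]

/-- The gradient is orthogonal to dilations. -/
theorem sum_gradPair {x₁ x₂ x₃ y₁ y₂ y₃ : ℝ}
    (hxy₁ : x₁ * y₁ = 1) (hxy₂ : x₂ * y₂ = 1) (hxy₃ : x₃ * y₃ = 1)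
    (hx : x₁ ^ 2 + x₂ ^ 2 + x₃ ^ 2 = 3) :
    gradPair x₁ y₁ y₂ y₃ + gradPair x₂ y₁ y₂ y₃ + gradPair x₃ y₁ y₂ y₃ = 0 := by
  simp only [gradPair, virial, powSum, inv_eq_of_mul_eq_one_right hxy₁,
    inv_eq_of_mul_eq_one_right hxy₂, inv_eq_of_mul_eq_one_right hxy₃]
  linear_combination (y₁ + y₂ + y₃ - y₁ ^ 3 - y₂ ^ 3 - y₃ ^ 3) * hx

/-- This identifies `gradSq` as a squared length: the gradient has zero sum and is orthogonal to the
sides, so its squared norm reduces to -3 times this sum. -/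
theorem sum_cube_mul_gradPair {x₁ x₂ x₃ y₁ y₂ y₃ : ℝ}
    (hxy₁ : x₁ * y₁ = 1) (hxy₂ : x₂ * y₂ = 1) (hxy₃ : x₃ * y₃ = 1) :
    y₁ ^ 3 * gradPair x₁ y₁ y₂ y₃ + y₂ ^ 3 * gradPair x₂ y₁ y₂ y₃
      + y₃ ^ 3 * gradPair x₃ y₁ y₂ y₃ = -gradSq y₁ y₂ y₃ := by
  have m₁ : x₁ ^ 2 * y₁ ^ 3 = y₁ := by linear_combination (x₁ * y₁ ^ 2 + y₁) * hxy₁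
  have m₂ : x₂ ^ 2 * y₂ ^ 3 = y₂ := by linear_combination (x₂ * y₂ ^ 2 + y₂) * hxy₂
  have m₃ : x₃ ^ 2 * y₃ ^ 3 = y₃ := by linear_combination (x₃ * y₃ ^ 2 + y₃) * hxy₃
  simp only [gradPair, virial, gradSq, powSum, inv_eq_of_mul_eq_one_right hxy₁,
    inv_eq_of_mul_eq_one_right hxy₂, inv_eq_of_mul_eq_one_right hxy₃]
  linear_combination (y₁ + y₂ + y₃ - y₁ ^ 3 - y₂ ^ 3 - y₃ ^ 3) * (m₁ + m₂ + m₃)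

/-- A velocity along which the configurational measure is stationary is a combination of a
dilation, a rotation and a shape velocity along the level line of the measure. -/
theorem velocity_decomposition {d₁ d₂ d₃ e₁ e₂ e₃ : ℂ} {x₁ x₂ x₃ y₁ y₂ y₃ J C T w : ℝ}
    (hd : d₁ + d₂ + d₃ = 0) (he : e₁ + e₂ + e₃ = 0)
    (hxy₁ : x₁ * y₁ = 1) (hxy₂ : x₂ * y₂ = 1) (hxy₃ : x₃ * y₃ = 1)
    (hx : x₁ ^ 2 + x₂ ^ 2 + x₃ ^ 2 = 3)
    (hd₁ : conj d₁ * d₁ = x₁ ^ 2) (hd₂ : conj d₂ * d₂ = x₂ ^ 2) (hd₃ : conj d₃ * d₃ = x₃ ^ 2)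
    (hw : (conj d₁ * d₂).im = w)
    (hJ : (conj d₁ * e₁).re + (conj d₂ * e₂).re + (conj d₃ * e₃).re = 3 * J)
    (hC : (conj d₁ * e₁).im + (conj d₂ * e₂).im + (conj d₃ * e₃).im = 3 * C)
    (hT : Complex.normSq e₁ + Complex.normSq e₂ + Complex.normSq e₃ = 3 * T)
    (hμ : y₁ ^ 3 * (conj d₁ * e₁).re + y₂ ^ 3 * (conj d₂ * e₂).re + y₃ ^ 3 * (conj d₃ * e₃).re
      = powSum 1 y₁ y₂ y₃ * J)
    (hΓ : gradSq y₁ y₂ y₃ ≠ 0) :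
    ∃ σ : ℝ,
      conj d₁ * e₁ = (J + Complex.I * C) * x₁ ^ 2
        + Complex.I * σ * (gradPair x₁ y₁ y₂ y₃ + Complex.I * w * (y₂ ^ 3 - y₃ ^ 3)) ∧
      conj d₂ * e₂ = (J + Complex.I * C) * x₂ ^ 2
        + Complex.I * σ * (gradPair x₂ y₁ y₂ y₃ + Complex.I * w * (y₃ ^ 3 - y₁ ^ 3)) ∧
      conj d₃ * e₃ = (J + Complex.I * C) * x₃ ^ 2
        + Complex.I * σ * (gradPair x₃ y₁ y₂ y₃ + Complex.I * w * (y₁ ^ 3 - y₂ ^ 3)) ∧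
      T = J ^ 2 + C ^ 2 + σ ^ 2 * gradSq y₁ y₂ y₃ := by
  have hdc : conj d₁ + conj d₂ + conj d₃ = 0 := by
    rw [← map_add, ← map_add, hd, map_zero]
  -- Law of cosines for the real parts; the imaginary part is the oriented area, common to all three
  -- pairs of sides.
  have key : ∀ a b c : ℂ, ∀ r s t v : ℝ, a + b + c = 0 → conj a * a = r ^ 2 → conj b * b = s ^ 2 →
      conj c * c = t ^ 2 → (conj a * b).im = v →
      conj a * b = (t ^ 2 - r ^ 2 - s ^ 2) / 2 + Complex.I * v ∧
      conj a * c = (s ^ 2 - r ^ 2 - t ^ 2) / 2 - Complex.I * v := by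
    intro a b c r s t v h ha hb hc hv
    obtain rfl : c = -a - b := by linear_combination h
    have h1 : conj a * b = ((conj a * b).re : ℂ) + Complex.I * v := by
      rw [← hv, mul_comm Complex.I]
      exact (Complex.re_add_im _).symm
    have h2 : a * conj b = ((conj a * b).re : ℂ) - Complex.I * v := by
      have h3 := congrArg conj h1
      simpa [Complex.conj_ofReal, Complex.conj_I, sub_eq_add_neg] using h3
    rw [map_sub, map_neg] at hc
    constructor
    · linear_combination h1 + (hc - ha - hb - h1 - h2) / 2
    · linear_combination -h1 - (hc - ha - hb - h1 - h2) / 2 - ha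
  obtain ⟨p₁, q₁⟩ := key d₁ d₂ d₃ x₁ x₂ x₃ w hd hd₁ hd₂ hd₃ hw
  have hw₂ : (conj d₂ * d₃).im = w := by
    have h1 : d₃ = -d₁ - d₂ := by linear_combination hd
    rw [← hw, h1]
    simp
    ring
  have hw₃ : (conj d₃ * d₁).im = w := by
    have h1 : d₃ = -d₁ - d₂ := by linear_combination hd
    rw [← hw, h1]
    simp
    ring
  obtain ⟨p₂, q₂⟩ := key d₂ d₃ d₁ x₂ x₃ x₁ w (by linear_combination hd) hd₂ hd₃ hd₁ hw₂
  obtain ⟨p₃, q₃⟩ := key d₃ d₁ d₂ x₃ x₁ x₂ w (by linear_combination hd) hd₃ hd₁ hd₂ hw₃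
  have r₁ := conj_mul_grad hxy₁ hxy₂ hxy₃ hx hd₁ p₁ q₁
  have r₂ := conj_mul_grad hxy₂ hxy₃ hxy₁ (by linear_combination hx) hd₂ p₂ q₂
  have r₃ := conj_mul_grad hxy₃ hxy₁ hxy₂ (by linear_combination hx) hd₃ p₃ q₃
  rw [powSum_rotate, gradPair_rotate] at r₂
  rw [← powSum_rotate 1 y₃, ← gradPair_rotate x₃ y₃] at r₃
  set Γ := gradSq y₁ y₂ y₃ with hΓ'
  set μ := powSum 1 y₁ y₂ y₃ with hμ'
  set t₁ := gradPair x₁ y₁ y₂ y₃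
  set t₂ := gradPair x₂ y₁ y₂ y₃
  set t₃ := gradPair x₃ y₁ y₂ y₃
  have ht : (t₁ : ℂ) + t₂ + t₃ = 0 := by exact_mod_cast sum_gradPair hxy₁ hxy₂ hxy₃ hx
  have hyt : (y₁ : ℂ) ^ 3 * t₁ + y₂ ^ 3 * t₂ + y₃ ^ 3 * t₃ = -Γ := by
    exact_mod_cast sum_cube_mul_gradPair hxy₁ hxy₂ hxy₃
  set S : ℂ := y₁ ^ 3 * d₁ + y₂ ^ 3 * d₂ + y₃ ^ 3 * d₃ with hS
  set Y₁ : ℂ := (μ - 3 * y₁ ^ 3) * d₁ + S with hY₁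
  set Y₂ : ℂ := (μ - 3 * y₂ ^ 3) * d₂ + (y₂ ^ 3 * d₂ + y₃ ^ 3 * d₃ + y₁ ^ 3 * d₁) with hY₂
  set Y₃ : ℂ := (μ - 3 * y₃ ^ 3) * d₃ + (y₃ ^ 3 * d₃ + y₁ ^ 3 * d₁ + y₂ ^ 3 * d₂) with hY₃
  have hcY₁ : conj Y₁ = (μ - 3 * y₁ ^ 3) * conj d₁ + conj S := by
    simp [hY₁, Complex.conj_ofReal, map_ofNat]
  have hcY₂ : conj Y₂ = (μ - 3 * y₂ ^ 3) * conj d₂ + conj S := by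
    simp [hY₂, hS, Complex.conj_ofReal, map_ofNat]
    ring
  have hcY₃ : conj Y₃ = (μ - 3 * y₃ ^ 3) * conj d₃ + conj S := by
    simp [hY₃, hS, Complex.conj_ofReal, map_ofNat]
    ring
  have hYs : Y₁ + Y₂ + Y₃ = 0 := by
    rw [hY₁, hY₂, hY₃, hS]
    linear_combination (μ : ℂ) * hd
  have hYsc : conj Y₁ + conj Y₂ + conj Y₃ = 0 := by
    rw [← map_add, ← map_add, hYs, map_zero]
  have horth : conj d₁ * Y₁ + conj d₂ * Y₂ + conj d₃ * Y₃ = 0 := by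
    linear_combination r₁ + r₂ + r₃ + ht
  have horthc : conj Y₁ * d₁ + conj Y₂ * d₂ + conj Y₃ * d₃ = 0 := by
    have h := congrArg conj horth
    simp only [map_add, map_mul, Complex.conj_conj, map_zero] at h
    linear_combination h
  have hn : conj d₁ * d₁ + conj d₂ * d₂ + conj d₃ * d₃ = 3 := by
    rw [hd₁, hd₂, hd₃]
    exact_mod_cast hx
  have hp : conj Y₁ * Y₁ + conj Y₂ * Y₂ + conj Y₃ * Y₃ = 3 * Γ := by
    rw [hcY₁, hcY₂, hcY₃]
    linear_combination conj S * hYs + (μ : ℂ) * horth - 3 * (y₁ : ℂ) ^ 3 * r₁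
      - 3 * (y₂ : ℂ) ^ 3 * r₂ - 3 * (y₃ : ℂ) ^ 3 * r₃ - 3 * hyt
  have hq : conj d₁ * e₁ + conj d₂ * e₂ + conj d₃ * e₃ = 3 * (J + Complex.I * C) := by
    apply Complex.ext
    · simpa using hJ
    · simpa using hC
  set Z := conj Y₁ * e₁ + conj Y₂ * e₂ + conj Y₃ * e₃ with hZ
  have hZ' : Z = ((μ - 3 * y₁ ^ 3 : ℝ) : ℂ) * (conj d₁ * e₁)
      + ((μ - 3 * y₂ ^ 3 : ℝ) : ℂ) * (conj d₂ * e₂)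
      + ((μ - 3 * y₃ ^ 3 : ℝ) : ℂ) * (conj d₃ * e₃) := by
    rw [hZ, hcY₁, hcY₂, hcY₃]
    push_cast
    linear_combination conj S * he
  -- Stationarity of the measure: the velocity has no real component along the gradient. What
  -- remains is i times a real multiple, the direction of the level line.
  have hZre : Z.re = 0 := by
    rw [hZ']
    simp only [Complex.add_re, Complex.re_ofReal_mul]
    linear_combination μ * hJ - 3 * hμ
  have hΓc : (Γ : ℂ) ≠ 0 := by exact_mod_cast hΓ
  obtain ⟨σ, hσ⟩ : ∃ σ : ℝ, Z = 3 * Complex.I * Γ * σ := by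
    refine ⟨Z.im / (3 * Γ), ?_⟩
    have h : Z = Z.im * Complex.I := by
      conv_lhs => rw [← Complex.re_add_im Z, hZre]
      simp
    push_cast
    rw [h]
    field_simp
    simp
  have f₁ : e₁ = (J + Complex.I * C) * d₁ + Complex.I * σ * Y₁ := by
    have h := gram_expansion hd hdc hYs hYsc he horth horthc
    rw [hn, hp, hq, ← hZ, hσ] at h
    have h9 : (9 * Γ : ℂ) ≠ 0 := mul_ne_zero (by norm_num) hΓc
    apply mul_left_cancel₀ h9
    linear_combination h
  have f₂ : e₂ = (J + Complex.I * C) * d₂ + Complex.I * σ * Y₂ := by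
    have h := gram_expansion (d₁ := d₂) (d₂ := d₃) (d₃ := d₁) (d₁' := conj d₂) (d₂' := conj d₃)
      (d₃' := conj d₁) (Y₁ := Y₂) (Y₂ := Y₃) (Y₃ := Y₁) (Y₁' := conj Y₂) (Y₂' := conj Y₃)
      (Y₃' := conj Y₁) (e₁ := e₂) (e₂ := e₃) (e₃ := e₁)
      (by linear_combination hd) (by linear_combination hdc) (by linear_combination hYs)
      (by linear_combination hYsc) (by linear_combination he) (by linear_combination horth)
      (by linear_combination horthc)
    have hn' : conj d₂ * d₂ + conj d₃ * d₃ + conj d₁ * d₁ = 3 := by linear_combination hn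
    have hp' : conj Y₂ * Y₂ + conj Y₃ * Y₃ + conj Y₁ * Y₁ = 3 * Γ := by linear_combination hp
    have hq' : conj d₂ * e₂ + conj d₃ * e₃ + conj d₁ * e₁ = 3 * (J + Complex.I * C) := by
      linear_combination hq
    have hZ'' : conj Y₂ * e₂ + conj Y₃ * e₃ + conj Y₁ * e₁ = 3 * Complex.I * Γ * σ := by
      linear_combination hσ
    rw [hn', hp', hq', hZ''] at h
    have h9 : (9 * Γ : ℂ) ≠ 0 := mul_ne_zero (by norm_num) hΓc
    apply mul_left_cancel₀ h9
    linear_combination h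
  have f₃ : e₃ = (J + Complex.I * C) * d₃ + Complex.I * σ * Y₃ := by
    linear_combination he - f₁ - f₂ - (J + Complex.I * C) * hd - Complex.I * σ * hYs
  refine ⟨σ, ?_, ?_, ?_, ?_⟩
  · linear_combination conj d₁ * f₁ + (J + Complex.I * C) * hd₁ + Complex.I * σ * r₁
  · linear_combination conj d₂ * f₂ + (J + Complex.I * C) * hd₂ + Complex.I * σ * r₂
  · linear_combination conj d₃ * f₃ + (J + Complex.I * C) * hd₃ + Complex.I * σ * r₃
  · have c₁ := congrArg conj f₁
    have c₂ := congrArg conj f₂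
    have c₃ := congrArg conj f₃
    simp only [map_add, map_mul, Complex.conj_ofReal, Complex.conj_I] at c₁ c₂ c₃
    have h : (3 * T : ℂ) = 3 * (J ^ 2 + C ^ 2 + σ ^ 2 * Γ) := by
      have h3 : ((Complex.normSq e₁ : ℝ) : ℂ) + (Complex.normSq e₂ : ℝ) + (Complex.normSq e₃ : ℝ)
          = 3 * T := by exact_mod_cast hT
      rw [Complex.normSq_eq_conj_mul_self, Complex.normSq_eq_conj_mul_self,
        Complex.normSq_eq_conj_mul_self] at h3
      linear_combination -h3 + e₁ * c₁ + e₂ * c₂ + e₃ * c₃ + (J - Complex.I * C) * hq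
        - Complex.I * σ * hσ - 3 * (σ ^ 2 * Γ + C ^ 2) * Complex.I_sq
    have h' : (T : ℂ) = J ^ 2 + C ^ 2 + σ ^ 2 * Γ := by linear_combination h / 3
    exact_mod_cast h'

/-- The second order stationarity condition of the configurational measure along a motion,
in terms of the shape speed `σ`. -/
theorem level_curvature_equation {x₁ x₂ x₃ y₁ y₂ y₃ g₁ g₂ g₃ h₁ h₂ h₃ J C T w σ m : ℝ}
    (hxy₁ : x₁ * y₁ = 1) (hxy₂ : x₂ * y₂ = 1) (hxy₃ : x₃ * y₃ = 1)
    (hg₁ : g₁ = J * x₁ ^ 2 - σ * w * (y₂ ^ 3 - y₃ ^ 3))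
    (hg₂ : g₂ = J * x₂ ^ 2 - σ * w * (y₃ ^ 3 - y₁ ^ 3))
    (hg₃ : g₃ = J * x₃ ^ 2 - σ * w * (y₁ ^ 3 - y₂ ^ 3))
    (hh₁ : h₁ = C * x₁ ^ 2 + σ * gradPair x₁ y₁ y₂ y₃)
    (hh₂ : h₂ = C * x₂ ^ 2 + σ * gradPair x₂ y₁ y₂ y₃)
    (hh₃ : h₃ = C * x₃ ^ 2 + σ * gradPair x₃ y₁ y₂ y₃)
    (hT : T = J ^ 2 + C ^ 2 + σ ^ 2 * gradSq y₁ y₂ y₃)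
    (hacc : -2 * (y₁ ^ 5 * g₁ ^ 2 + y₂ ^ 5 * g₂ ^ 2 + y₃ ^ 5 * g₃ ^ 2)
      + (y₁ ^ 5 * h₁ ^ 2 + y₂ ^ 5 * h₂ ^ 2 + y₃ ^ 5 * h₃ ^ 2)
      + 3 * J * (y₁ ^ 3 * g₁ + y₂ ^ 3 * g₂ + y₃ ^ 3 * g₃)
      + m * (y₁ ^ 3 * virial x₁ y₁ y₂ y₃ + y₂ ^ 3 * virial x₂ y₁ y₂ y₃
        + y₃ ^ 3 * virial x₃ y₁ y₂ y₃)
      - powSum 1 y₁ y₂ y₃ * (T - m * powSum 1 y₁ y₂ y₃) = 0) :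
    m * gradSq y₁ y₂ y₃ + 2 * C * σ * gradSq y₁ y₂ y₃
      + σ ^ 2 * levelHess (w ^ 2) y₁ y₂ y₃ = 0 := by
  have hyt := sum_cube_mul_gradPair hxy₁ hxy₂ hxy₃
  have m₁ : x₁ ^ 2 * y₁ ^ 3 = y₁ := by linear_combination (x₁ * y₁ ^ 2 + y₁) * hxy₁
  have m₂ : x₂ ^ 2 * y₂ ^ 3 = y₂ := by linear_combination (x₂ * y₂ ^ 2 + y₂) * hxy₂
  have m₃ : x₃ ^ 2 * y₃ ^ 3 = y₃ := by linear_combination (x₃ * y₃ ^ 2 + y₃) * hxy₃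
  have expand : ∀ x y η g h t v : ℝ, x * y = 1 → x ^ 2 * y ^ 3 = y →
      g = J * x ^ 2 - σ * w * η → h = C * x ^ 2 + σ * t →
      v = t - powSum 1 y₁ y₂ y₃ * x ^ 2 →
      t = (powSum 1 y₁ y₂ y₃ - powSum 3 y₁ y₂ y₃) * x ^ 2
        + (3 / 2 * powSum 3 y₁ y₂ y₃ - powSum 1 y₁ y₂ y₃) - 3 / 2 * y ^ 3 →
      y ^ 3 * g = J * y - σ * w * (y ^ 3 * η) ∧
      y ^ 5 * g ^ 2 = J ^ 2 * y - 2 * J * σ * w * (y ^ 3 * η) + σ ^ 2 * w ^ 2 * (y ^ 5 * η ^ 2) ∧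
      y ^ 5 * h ^ 2 = C ^ 2 * y + 2 * C * σ * (y ^ 3 * t) + σ ^ 2 * (y ^ 5 * t ^ 2) ∧
      y ^ 3 * v = y ^ 3 * t - powSum 1 y₁ y₂ y₃ * y ∧
      y ^ 5 * t ^ 2 = (powSum 1 y₁ y₂ y₃ - powSum 3 y₁ y₂ y₃) ^ 2 * y
        + (3 / 2 * powSum 3 y₁ y₂ y₃ - powSum 1 y₁ y₂ y₃) ^ 2 * y ^ 5 + 9 / 4 * y ^ 11
        + 2 * (powSum 1 y₁ y₂ y₃ - powSum 3 y₁ y₂ y₃)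
          * (3 / 2 * powSum 3 y₁ y₂ y₃ - powSum 1 y₁ y₂ y₃) * y ^ 3
        - 3 * (powSum 1 y₁ y₂ y₃ - powSum 3 y₁ y₂ y₃) * y ^ 6
        - 3 * (3 / 2 * powSum 3 y₁ y₂ y₃ - powSum 1 y₁ y₂ y₃) * y ^ 8 := by
    intro x y η g h t v hxy hm hg hh hv ht
    have hy : y ≠ 0 := right_ne_zero_of_mul_eq_one hxy
    have hx : x = y⁻¹ := eq_inv_of_mul_eq_one_left hxy
    refine ⟨?_, ?_, ?_, ?_, ?_⟩
    · rw [hg]; linear_combination J * hm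
    · rw [hg, hx]; field_simp; ring
    · rw [hh, hx]; field_simp; ring
    · rw [hv]; linear_combination -powSum 1 y₁ y₂ y₃ * hm
    · rw [ht, hx]; field_simp; ring
  obtain ⟨a₁, b₁, c₁, d₁, e₁⟩ := expand x₁ y₁ _ g₁ h₁ _ (virial x₁ y₁ y₂ y₃) hxy₁ m₁ hg₁ hh₁
    (by simp only [gradPair]; ring)
    (by simp only [gradPair, virial, inv_eq_of_mul_eq_one_right hxy₁]; ring)
  obtain ⟨a₂, b₂, c₂, d₂, e₂⟩ := expand x₂ y₂ _ g₂ h₂ _ (virial x₂ y₁ y₂ y₃) hxy₂ m₂ hg₂ hh₂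
    (by simp only [gradPair]; ring)
    (by simp only [gradPair, virial, inv_eq_of_mul_eq_one_right hxy₂]; ring)
  obtain ⟨a₃, b₃, c₃, d₃, e₃⟩ := expand x₃ y₃ _ g₃ h₃ _ (virial x₃ y₁ y₂ y₃) hxy₃ m₃ hg₃ hh₃
    (by simp only [gradPair]; ring)
    (by simp only [gradPair, virial, inv_eq_of_mul_eq_one_right hxy₃]; ring)
  -- This collects the coefficient of σ². In the final combination the terms in `J` cancel, because
  -- the coefficients of `w` weighted by the cubes sum to zero.
  have hsum : y₁ ^ 5 * gradPair x₁ y₁ y₂ y₃ ^ 2 + y₂ ^ 5 * gradPair x₂ y₁ y₂ y₃ ^ 2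
      + y₃ ^ 5 * gradPair x₃ y₁ y₂ y₃ ^ 2
      = 2 * w ^ 2 * (y₁ ^ 5 * (y₂ ^ 3 - y₃ ^ 3) ^ 2 + y₂ ^ 5 * (y₃ ^ 3 - y₁ ^ 3) ^ 2
        + y₃ ^ 5 * (y₁ ^ 3 - y₂ ^ 3) ^ 2)
        + powSum 1 y₁ y₂ y₃ * gradSq y₁ y₂ y₃ - levelHess (w ^ 2) y₁ y₂ y₃ := by
    rw [e₁, e₂, e₃, levelHess]
    simp only [powSum]
    ring
  have hs : y₁ + y₂ + y₃ = powSum 1 y₁ y₂ y₃ := by simp [powSum]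
  rw [b₁, b₂, b₃, c₁, c₂, c₃, a₁, a₂, a₃, d₁, d₂, d₃, hT] at hacc
  linear_combination -hacc + σ ^ 2 * hsum + (m + 2 * C * σ) * hyt
    + (J ^ 2 + C ^ 2 - m * powSum 1 y₁ y₂ y₃) * hs

end

/-! ### Rational parametrization of a level line by the normalized perimeter. -/

noncomputable section
open Polynomial

/-- The squared shape velocity of the normalized perimeter along the level line of the measure. -/
def perimeterSpeedSq (W y₁ y₂ y₃ : ℝ) : ℝ :=
  W * (y₁ * (y₂ ^ 3 - y₃ ^ 3) + y₂ * (y₃ ^ 3 - y₁ ^ 3) + y₃ * (y₁ ^ 3 - y₂ ^ 3)) ^ 2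

theorem powSum_add_three (n : ℕ) (y₁ y₂ y₃ : ℝ) :
    powSum (n + 3) y₁ y₂ y₃ = (y₁ + y₂ + y₃) * powSum (n + 2) y₁ y₂ y₃
      - (y₁ * y₂ + y₂ * y₃ + y₃ * y₁) * powSum (n + 1) y₁ y₂ y₃
      + y₁ * y₂ * y₃ * powSum n y₁ y₂ y₃ := by
  simp only [powSum]
  ring

/-- The relations between the inverse normalized distances, the measure `μ` and the normalized
perimeter `s`. -/
structure ShapeRel (μ s y₁ y₂ y₃ : ℝ) : Prop where
  esymm_one : y₁ + y₂ + y₃ = μ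
  esymm_two : (y₁ * y₂ + y₂ * y₃ + y₃ * y₁) * (s ^ 2 - 3) = 2 * μ * s
  esymm_three : y₁ * y₂ * y₃ * (s ^ 2 - 3) = 2 * μ

/-- Newton's recursion: the second and third elementary symmetric functions each have a simple
denominator s² - 3, so raising the index by two costs one more factor. -/
theorem exists_poly_powSum (μ : ℝ) (l : ℕ) :
    ∃ p q r : ℝ[X], ∀ s y₁ y₂ y₃, ShapeRel μ s y₁ y₂ y₃ →
      powSum (2 * l) y₁ y₂ y₃ * (s ^ 2 - 3) ^ l = p.eval s ∧
      powSum (2 * l + 1) y₁ y₂ y₃ * (s ^ 2 - 3) ^ l = q.eval s ∧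
      powSum (2 * l + 2) y₁ y₂ y₃ * (s ^ 2 - 3) ^ (l + 1) = r.eval s := by
  induction l with
  | zero =>
    refine ⟨3, C μ, C (μ ^ 2) * (X ^ 2 - 3) - C (4 * μ) * X, fun s y₁ y₂ y₃ h => ⟨?_, ?_, ?_⟩⟩
    · simp [powSum]; norm_num
    · simp [powSum, h.esymm_one]
    · simp [powSum]
      linear_combination (y₁ + y₂ + y₃ + μ) * (s ^ 2 - 3) * h.esymm_one - 2 * h.esymm_two
  | succ l ih =>
    obtain ⟨p, q, r, hpqr⟩ := ih
    refine ⟨r, C μ * r - C (2 * μ) * X * q + C (2 * μ) * p,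
      C μ * (X ^ 2 - 3) * (C μ * r - C (2 * μ) * X * q + C (2 * μ) * p) - C (2 * μ) * X * r
        + C (2 * μ) * (X ^ 2 - 3) * q, fun s y₁ y₂ y₃ h => ?_⟩
    obtain ⟨h1, h2, h3⟩ := hpqr s y₁ y₂ y₃ h
    have h4 : powSum (2 * (l + 1) + 1) y₁ y₂ y₃ * (s ^ 2 - 3) ^ (l + 1)
        = μ * r.eval s - 2 * μ * s * q.eval s + 2 * μ * p.eval s := by
      rw [show 2 * (l + 1) + 1 = 2 * l + 3 by ring, powSum_add_three, h.esymm_one, ← h1, ← h2, ← h3]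
      linear_combination -powSum (2 * l + 1) y₁ y₂ y₃ * (s ^ 2 - 3) ^ l * h.esymm_two
        + powSum (2 * l) y₁ y₂ y₃ * (s ^ 2 - 3) ^ l * h.esymm_three
    refine ⟨?_, ?_, ?_⟩
    · rw [show 2 * (l + 1) = 2 * l + 2 by ring, h3]
    · simp [h4]
    · simp only [eval_add, eval_sub, eval_mul, eval_C, eval_X, eval_pow, eval_ofNat, ← h4]
      rw [show 2 * (l + 1) + 2 = 2 * l + 1 + 3 by ring, powSum_add_three, h.esymm_one, ← h2, ← h3,
        show 2 * (l + 1) + 1 = 2 * l + 1 + 2 by ring, show 2 * l + 1 + 1 = 2 * l + 2 by ring]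
      linear_combination -powSum (2 * l + 2) y₁ y₂ y₃ * (s ^ 2 - 3) ^ (l + 1) * h.esymm_two
        + powSum (2 * l + 1) y₁ y₂ y₃ * (s ^ 2 - 3) ^ (l + 1) * h.esymm_three

/-- On a level line of the measure, the shape functions are rational in the normalized perimeter,
with poles only at `±√3`. -/
theorem exists_shape_polynomials {μ : ℝ} (hμ : μ ≠ 0) :
    ∃ N δ M : ℝ[X], N.eval √3 ≠ 0 ∧ δ.eval √3 ≠ 0 ∧
      ∀ s W y₁ y₂ y₃, ShapeRel μ s y₁ y₂ y₃ →
        4 * W * μ = s * (μ * s ^ 3 - 6 * μ * s - 4 * (s ^ 2 - 3)) →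
        gradSq y₁ y₂ y₃ * (s ^ 2 - 3) ^ 3 = N.eval s ∧
        perimeterSpeedSq W y₁ y₂ y₃ * (s ^ 2 - 3) ^ 3 = δ.eval s ∧
        levelHess W y₁ y₂ y₃ * (s ^ 2 - 3) ^ 5 = M.eval s := by
  obtain ⟨_, p₃, _, H₁⟩ := exists_poly_powSum μ 1
  obtain ⟨_, p₅, p₆, H₂⟩ := exists_poly_powSum μ 2
  obtain ⟨p₈, _, _, H₄⟩ := exists_poly_powSum μ 4
  obtain ⟨_, p₁₁, _, H₅⟩ := exists_poly_powSum μ 5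
  have h3 : (√3 : ℝ) ^ 2 = 3 := Real.sq_sqrt (by norm_num)
  have h3' : (√3 : ℝ) ≠ 0 := by positivity
  set D : ℝ[X] := X ^ 2 - 3 with hD
  have hDev : ∀ s, D.eval s = s ^ 2 - 3 := fun s => by simp [hD]
  set W' : ℝ[X] := C (1 / (4 * μ)) * X * (C μ * X ^ 3 - C (6 * μ) * X - 4 * D) with hW'
  -- `N` and `V` are explicit because their values at √3 are needed. `V` is the cleared discriminant
  -- of the cubic with roots y_i: the squared alternating sum in `perimeterSpeedSq` is that
  -- discriminant times (y₁ + y₂ + y₃)².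
  set N : ℝ[X] := -3 * (C (2 * μ) * X) ^ 3 + C (36 * μ ^ 3) * X * D - C (36 * μ ^ 2) * D
    + C (2 * μ ^ 4 - μ ^ 2) * D ^ 3 - C (12 * μ ^ 3) * X * D ^ 2 + C (12 * μ ^ 2) * D ^ 2 with hN
  set V : ℝ[X] := C (4 * μ ^ 4) * X ^ 2 * D - 4 * (C (2 * μ) * X) ^ 3 - C (8 * μ ^ 4) * D ^ 2
    + C (72 * μ ^ 3) * X * D - C (108 * μ ^ 2) * D with hV
  refine ⟨N, C (μ ^ 2) * W' * V,
    2 * W' * (2 * p₅ * p₆ - 3 * p₁₁ - D * p₃ ^ 2 * p₅ + 2 * p₃ * p₈)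
      - ((C μ * D - p₃) ^ 2 * C μ * D ^ 3 + (C (3 / 2) * p₃ - C μ * D) ^ 2 * p₅ * D + C (9 / 4) * p₁₁
        + 2 * (C μ * D - p₃) * (C (3 / 2) * p₃ - C μ * D) * p₃ * D ^ 2
        - 3 * (C μ * D - p₃) * p₆ * D - 3 * (C (3 / 2) * p₃ - C μ * D) * p₈)
      + C μ * N * D ^ 2, ?_, ?_, ?_⟩
  · have : N.eval √3 = -3 * (2 * μ * √3) ^ 3 := by simp [hN, hDev, h3]
    rw [this]
    positivity
  · have h4 : W'.eval √3 = 1 / (4 * μ) * (-(3 * μ) * (√3) ^ 2) := by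
      have : (√3 : ℝ) ^ 3 = 3 * √3 := by rw [pow_succ, h3]
      simp [hW', hDev, this, h3]
      linear_combination (-3 * μ * μ⁻¹ * 4⁻¹) * h3
    have h5 : V.eval √3 = -4 * (2 * μ * √3) ^ 3 := by simp [hV, hDev, h3]
    rw [eval_mul, eval_mul, h4, h5, eval_C]
    have : -(3 * μ) ≠ 0 := neg_ne_zero.2 (by positivity)
    have : (-4 : ℝ) ≠ 0 := by norm_num
    positivity
  · intro s W y₁ y₂ y₃ h hW
    obtain ⟨-, e₃, -⟩ := H₁ s y₁ y₂ y₃ h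
    obtain ⟨-, e₅, e₆⟩ := H₂ s y₁ y₂ y₃ h
    obtain ⟨e₈, -, -⟩ := H₄ s y₁ y₂ y₃ h
    obtain ⟨-, e₁₁, -⟩ := H₅ s y₁ y₂ y₃ h
    norm_num at e₃ e₅ e₆ e₈ e₁₁
    have e₁ : powSum 1 y₁ y₂ y₃ = μ := by simp [powSum, h.esymm_one]
    have hWe : W'.eval s = W := by
      simp [hW', hDev]
      field_simp
      linear_combination -hW
    have f₁ := h.esymm_one
    have f₂ := h.esymm_two
    have f₃ := h.esymm_three
    have hNe : gradSq y₁ y₂ y₃ * (s ^ 2 - 3) ^ 3 = N.eval s := by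
      have h1 : gradSq y₁ y₂ y₃ = -3 * (y₁ * y₂ + y₂ * y₃ + y₃ * y₁) ^ 3
          + 9 * (y₁ + y₂ + y₃) * (y₁ * y₂ + y₂ * y₃ + y₃ * y₁) * (y₁ * y₂ * y₃)
          - 9 * (y₁ * y₂ * y₃) ^ 2 + 2 * (y₁ + y₂ + y₃) ^ 4
          - 6 * (y₁ + y₂ + y₃) ^ 2 * (y₁ * y₂ + y₂ * y₃ + y₃ * y₁)
          + 6 * (y₁ + y₂ + y₃) * (y₁ * y₂ * y₃) - (y₁ + y₂ + y₃) ^ 2 := by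
        simp only [gradSq, powSum]; ring
      have h2 : N.eval s = -3 * (2 * μ * s) ^ 3 + 9 * μ * (2 * μ * s) * (2 * μ) * (s ^ 2 - 3)
          - 9 * (2 * μ) ^ 2 * (s ^ 2 - 3) + 2 * μ ^ 4 * (s ^ 2 - 3) ^ 3
          - 6 * μ ^ 2 * (2 * μ * s) * (s ^ 2 - 3) ^ 2 + 6 * μ * (2 * μ) * (s ^ 2 - 3) ^ 2
          - μ ^ 2 * (s ^ 2 - 3) ^ 3 := by
        simp [hN, hDev]; ring
      rw [h1, h2, ← f₂, ← f₃, f₁]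
      ring
    refine ⟨hNe, ?_, ?_⟩
    · have h1 : perimeterSpeedSq W y₁ y₂ y₃ = W * (y₁ + y₂ + y₃) ^ 2 *
          ((y₁ + y₂ + y₃) ^ 2 * (y₁ * y₂ + y₂ * y₃ + y₃ * y₁) ^ 2
          - 4 * (y₁ * y₂ + y₂ * y₃ + y₃ * y₁) ^ 3 - 4 * (y₁ + y₂ + y₃) ^ 3 * (y₁ * y₂ * y₃)
          + 18 * (y₁ + y₂ + y₃) * (y₁ * y₂ + y₂ * y₃ + y₃ * y₁) * (y₁ * y₂ * y₃)
          - 27 * (y₁ * y₂ * y₃) ^ 2) := by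
        simp only [perimeterSpeedSq]; ring
      have h2 : V.eval s = μ ^ 2 * (2 * μ * s) ^ 2 * (s ^ 2 - 3) - 4 * (2 * μ * s) ^ 3
          - 4 * μ ^ 3 * (2 * μ) * (s ^ 2 - 3) ^ 2
          + 18 * μ * (2 * μ * s) * (2 * μ) * (s ^ 2 - 3) - 27 * (2 * μ) ^ 2 * (s ^ 2 - 3) := by
        simp [hV, hDev]; ring
      rw [eval_mul, eval_mul, hWe, eval_C, h1, h2, ← f₂, ← f₃, f₁]
      ring
    · simp only [eval_add, eval_sub, eval_mul, eval_pow, eval_C, eval_ofNat, hWe, hDev, ← hNe,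
        ← e₃, ← e₅, ← e₆, ← e₈, ← e₁₁]
      rw [levelHess, e₁]
      ring

end

/-! ### Moving triangles and their integrals of motion. -/

noncomputable section

/-- The sides `(a i, b i)` of a moving triangle in the plane and their velocities `(u i, v i)`. -/
structure SideMotion where
  a : Fin 3 → ℝ → ℝ
  b : Fin 3 → ℝ → ℝ
  u : Fin 3 → ℝ → ℝ
  v : Fin 3 → ℝ → ℝ

namespace SideMotion

variable (M : SideMotion)

/-- The length of a side. -/
def r (i : Fin 3) (t : ℝ) : ℝ := √(M.a i t ^ 2 + M.b i t ^ 2)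

/-- The square root of the moment of inertia about the centroid, for unit masses. -/
def size (t : ℝ) : ℝ := √((M.r 0 t ^ 2 + M.r 1 t ^ 2 + M.r 2 t ^ 2) / 3)

/-- The inner product of a side and its velocity. -/
def g (i : Fin 3) (t : ℝ) : ℝ := M.a i t * M.u i t + M.b i t * M.v i t

/-- The exterior product of a side and its velocity. -/
def h (i : Fin 3) (t : ℝ) : ℝ := M.a i t * M.v i t - M.b i t * M.u i t

/-- Half the time derivative of the moment of inertia. -/
def dilation (t : ℝ) : ℝ := (M.g 0 t + M.g 1 t + M.g 2 t) / 3

/-- The angular momentum about the centroid, for unit masses. -/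
def angular (t : ℝ) : ℝ := (M.h 0 t + M.h 1 t + M.h 2 t) / 3

/-- Twice the kinetic energy about the centroid, for unit masses. -/
def kinetic (t : ℝ) : ℝ :=
  ((M.u 0 t ^ 2 + M.v 0 t ^ 2) + (M.u 1 t ^ 2 + M.v 1 t ^ 2) + (M.u 2 t ^ 2 + M.v 2 t ^ 2)) / 3

/-- The normalized side length. -/
def x (i : Fin 3) (t : ℝ) : ℝ := M.r i t / M.size t

/-- The inverse normalized side length. -/
def y (i : Fin 3) (t : ℝ) : ℝ := M.size t / M.r i t

/-- Twice the oriented area of the normalized triangle. -/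
def area (t : ℝ) : ℝ := (M.a 0 t * M.b 1 t - M.b 0 t * M.a 1 t) / M.size t ^ 2

/-- The normalized perimeter. -/
def perimeter (t : ℝ) : ℝ := M.x 0 t + M.x 1 t + M.x 2 t

/-- The sides of a triangle move under Newtonian gravitation between three bodies of mass `m`,
with constant configurational measure `μ`. -/
structure IsNewtonian (m μ : ℝ) (J : Set ℝ) : Prop where
  isOpen : IsOpen J
  isPreconnected : IsPreconnected J
  mass_pos : 0 < m
  sum_a : ∀ t ∈ J, M.a 0 t + M.a 1 t + M.a 2 t = 0
  sum_b : ∀ t ∈ J, M.b 0 t + M.b 1 t + M.b 2 t = 0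
  sum_u : ∀ t ∈ J, M.u 0 t + M.u 1 t + M.u 2 t = 0
  sum_v : ∀ t ∈ J, M.v 0 t + M.v 1 t + M.v 2 t = 0
  side_pos : ∀ t ∈ J, ∀ i, 0 < M.a i t ^ 2 + M.b i t ^ 2
  hasDerivAt_a : ∀ t ∈ J, ∀ i, HasDerivAt (M.a i) (M.u i t) t
  hasDerivAt_b : ∀ t ∈ J, ∀ i, HasDerivAt (M.b i) (M.v i t) t
  hasDerivAt_u : ∀ t ∈ J, ∀ i, HasDerivAt (M.u i)
    (m * (M.a 0 t / M.r 0 t ^ 3 + M.a 1 t / M.r 1 t ^ 3 + M.a 2 t / M.r 2 t ^ 3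
      - 3 * (M.a i t / M.r i t ^ 3))) t
  hasDerivAt_v : ∀ t ∈ J, ∀ i, HasDerivAt (M.v i)
    (m * (M.b 0 t / M.r 0 t ^ 3 + M.b 1 t / M.r 1 t ^ 3 + M.b 2 t / M.r 2 t ^ 3
      - 3 * (M.b i t / M.r i t ^ 3))) t
  measure_eq : ∀ t ∈ J, M.y 0 t + M.y 1 t + M.y 2 t = μ

namespace IsNewtonian

variable {M : SideMotion} {m μ : ℝ} {J : Set ℝ} {t : ℝ}

theorem r_pos (H : M.IsNewtonian m μ J) (ht : t ∈ J) (i : Fin 3) : 0 < M.r i t :=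
  Real.sqrt_pos.2 (H.side_pos t ht i)

theorem r_sq (M : SideMotion) (i : Fin 3) (t : ℝ) :
    M.r i t ^ 2 = M.a i t ^ 2 + M.b i t ^ 2 :=
  Real.sq_sqrt (by positivity)

theorem size_sq (M : SideMotion) (t : ℝ) :
    M.size t ^ 2 = (M.r 0 t ^ 2 + M.r 1 t ^ 2 + M.r 2 t ^ 2) / 3 :=
  Real.sq_sqrt (by positivity)

theorem size_pos (H : M.IsNewtonian m μ J) (ht : t ∈ J) : 0 < M.size t := by
  have h0 := H.r_pos ht 0
  exact Real.sqrt_pos.2 (by positivity)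

theorem x_mul_y (H : M.IsNewtonian m μ J) (ht : t ∈ J) (i : Fin 3) : M.x i t * M.y i t = 1 := by
  have h0 := H.r_pos ht i
  have h1 := H.size_pos ht
  simp only [x, y]
  field_simp

theorem x_pos (H : M.IsNewtonian m μ J) (ht : t ∈ J) (i : Fin 3) : 0 < M.x i t :=
  div_pos (H.r_pos ht i) (H.size_pos ht)

theorem y_pos (H : M.IsNewtonian m μ J) (ht : t ∈ J) (i : Fin 3) : 0 < M.y i t :=
  div_pos (H.size_pos ht) (H.r_pos ht i)

theorem sum_x_sq (H : M.IsNewtonian m μ J) (ht : t ∈ J) :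
    M.x 0 t ^ 2 + M.x 1 t ^ 2 + M.x 2 t ^ 2 = 3 := by
  have h1 := H.size_pos ht
  have h2 := size_sq M t
  simp only [x]
  field_simp
  linear_combination -3 * h2

theorem hasDerivAt_r (H : M.IsNewtonian m μ J) (ht : t ∈ J) (i : Fin 3) :
    HasDerivAt (M.r i) (M.g i t / M.r i t) t := by
  have h := (((H.hasDerivAt_a t ht i).pow 2).add ((H.hasDerivAt_b t ht i).pow 2)).sqrt
    (H.side_pos t ht i).ne'
  refine h.congr_deriv ?_
  simp only [g, r, Pi.add_apply, Pi.pow_apply]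
  have := Real.sqrt_pos.2 (H.side_pos t ht i)
  field_simp
  simp
  ring

theorem hasDerivAt_size (H : M.IsNewtonian m μ J) (ht : t ∈ J) :
    HasDerivAt M.size (M.dilation t / M.size t) t := by
  have h1 := H.r_pos ht
  have h0 := h1 0
  have h := ((((H.hasDerivAt_r ht 0).pow 2).add ((H.hasDerivAt_r ht 1).pow 2)).add
    ((H.hasDerivAt_r ht 2).pow 2)).div_const 3
  have h := h.sqrt (by simp only [Pi.add_apply, Pi.pow_apply]; positivity)
  refine h.congr_deriv ?_
  have h2 := H.size_pos ht
  have h3 := (h1 0).ne'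
  have h4 := (h1 1).ne'
  have h5 := (h1 2).ne'
  simp only [dilation, Pi.add_apply, Pi.pow_apply]
  change _ / (2 * M.size t) = _
  simp only [Nat.cast_ofNat, Nat.add_one_sub_one, pow_one]
  field_simp

theorem hasDerivAt_x (H : M.IsNewtonian m μ J) (ht : t ∈ J) (i : Fin 3) :
    HasDerivAt (M.x i)
      ((M.g i t * M.y i t - M.dilation t * M.x i t) / M.size t ^ 2) t := by
  have h1 := H.r_pos ht i
  have h2 := H.size_pos ht
  refine ((H.hasDerivAt_r ht i).div (H.hasDerivAt_size ht) h2.ne').congr_deriv ?_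
  simp only [x, y]
  field_simp

theorem hasDerivAt_y (H : M.IsNewtonian m μ J) (ht : t ∈ J) (i : Fin 3) :
    HasDerivAt (M.y i)
      ((M.dilation t * M.y i t - M.g i t * M.y i t ^ 3) / M.size t ^ 2) t := by
  have h1 := H.r_pos ht i
  have h2 := H.size_pos ht
  refine ((H.hasDerivAt_size ht).div (H.hasDerivAt_r ht i) h1.ne').congr_deriv ?_
  simp only [y]
  field_simp

/-- First order stationarity: the derivative of the sum of the `M.y i` is zero. -/
theorem sum_cube_mul_g (H : M.IsNewtonian m μ J) (ht : t ∈ J) :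
    M.y 0 t ^ 3 * M.g 0 t + M.y 1 t ^ 3 * M.g 1 t + M.y 2 t ^ 3 * M.g 2 t
      = μ * M.dilation t := by
  have h2 := H.size_pos ht
  have h := ((H.hasDerivAt_y ht 0).add (H.hasDerivAt_y ht 1)).add (H.hasDerivAt_y ht 2)
  have h' : HasDerivAt (M.y 0 + M.y 1 + M.y 2) 0 t := by
    refine (hasDerivAt_const t μ).congr_of_eventuallyEq ?_
    filter_upwards [H.isOpen.mem_nhds ht] with s hs
    exact H.measure_eq s hs
  have h3 := h.unique h'
  field_simp at h3
  linear_combination -h3 + M.dilation t * H.measure_eq t ht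

/-- The inner products of different sides come from the closing relation and the definition of R, as
in the law of cosines. -/
theorem force_pairing {a₁ a₂ a₃ b₁ b₂ b₃ r₁ r₂ r₃ R : ℝ} (ha : a₁ + a₂ + a₃ = 0)
    (hb : b₁ + b₂ + b₃ = 0) (h₁ : 0 < r₁) (h₂ : 0 < r₂) (h₃ : 0 < r₃) (hR : 0 < R)
    (e₁ : r₁ ^ 2 = a₁ ^ 2 + b₁ ^ 2) (e₂ : r₂ ^ 2 = a₂ ^ 2 + b₂ ^ 2)
    (e₃ : r₃ ^ 2 = a₃ ^ 2 + b₃ ^ 2) (eR : R ^ 2 = (r₁ ^ 2 + r₂ ^ 2 + r₃ ^ 2) / 3) :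
    a₁ * (a₁ / r₁ ^ 3 + a₂ / r₂ ^ 3 + a₃ / r₃ ^ 3 - 3 * (a₁ / r₁ ^ 3))
      + b₁ * (b₁ / r₁ ^ 3 + b₂ / r₂ ^ 3 + b₃ / r₃ ^ 3 - 3 * (b₁ / r₁ ^ 3))
      = virial (r₁ / R) (R / r₁) (R / r₂) (R / r₃) / R := by
  have k₂ : a₁ * a₂ + b₁ * b₂ = 3 / 2 * R ^ 2 - r₁ ^ 2 - r₂ ^ 2 := by
    obtain rfl : a₃ = -a₁ - a₂ := by linear_combination ha
    obtain rfl : b₃ = -b₁ - b₂ := by linear_combination hb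
    linear_combination -3 / 2 * eR - e₃ / 2 + (e₁ + e₂) / 2
  have k₃ : a₁ * a₃ + b₁ * b₃ = 3 / 2 * R ^ 2 - r₁ ^ 2 - r₃ ^ 2 := by
    obtain rfl : a₂ = -a₁ - a₃ := by linear_combination ha
    obtain rfl : b₂ = -b₁ - b₃ := by linear_combination hb
    linear_combination -3 / 2 * eR - e₂ / 2 + (e₁ + e₃) / 2
  have h : a₁ * (a₁ / r₁ ^ 3 + a₂ / r₂ ^ 3 + a₃ / r₃ ^ 3 - 3 * (a₁ / r₁ ^ 3))
      + b₁ * (b₁ / r₁ ^ 3 + b₂ / r₂ ^ 3 + b₃ / r₃ ^ 3 - 3 * (b₁ / r₁ ^ 3))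
      = -2 * (r₁ ^ 2 / r₁ ^ 3) + (3 / 2 * R ^ 2 - r₁ ^ 2 - r₂ ^ 2) / r₂ ^ 3
        + (3 / 2 * R ^ 2 - r₁ ^ 2 - r₃ ^ 2) / r₃ ^ 3 := by
    rw [← k₂, ← k₃, e₁]
    ring
  rw [h]
  simp only [virial, powSum]
  field_simp
  ring

theorem hasDerivAt_g (H : M.IsNewtonian m μ J) (ht : t ∈ J) (i : Fin 3) :
    HasDerivAt (M.g i) (M.u i t ^ 2 + M.v i t ^ 2
      + m * (virial (M.x i t) (M.y 0 t) (M.y 1 t) (M.y 2 t) / M.size t)) t := by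
  refine (((H.hasDerivAt_a t ht i).mul (H.hasDerivAt_u t ht i)).add
    ((H.hasDerivAt_b t ht i).mul (H.hasDerivAt_v t ht i))).congr_deriv ?_
  have ha := H.sum_a t ht
  have hb := H.sum_b t ht
  have hr := H.r_pos ht
  have hs := r_sq M
  have hR := size_sq M t
  have key : M.a i t * (M.a 0 t / M.r 0 t ^ 3 + M.a 1 t / M.r 1 t ^ 3 + M.a 2 t / M.r 2 t ^ 3
        - 3 * (M.a i t / M.r i t ^ 3))
      + M.b i t * (M.b 0 t / M.r 0 t ^ 3 + M.b 1 t / M.r 1 t ^ 3 + M.b 2 t / M.r 2 t ^ 3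
        - 3 * (M.b i t / M.r i t ^ 3))
      = virial (M.x i t) (M.y 0 t) (M.y 1 t) (M.y 2 t) / M.size t := by
    fin_cases i
    · exact force_pairing ha hb (hr 0) (hr 1) (hr 2) (H.size_pos ht) (hs 0 t) (hs 1 t) (hs 2 t) hR
    · have h := force_pairing (by linear_combination ha) (by linear_combination hb)
        (hr 1) (hr 2) (hr 0) (H.size_pos ht) (hs 1 t) (hs 2 t) (hs 0 t) (by linear_combination hR)
      simp only [virial] at h ⊢
      rw [powSum_rotate 3, powSum_rotate 1] at h
      simp only [Fin.mk_one, x, y]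
      linear_combination h
    · have h := force_pairing (by linear_combination ha) (by linear_combination hb)
        (hr 2) (hr 0) (hr 1) (H.size_pos ht) (hs 2 t) (hs 0 t) (hs 1 t) (by linear_combination hR)
      simp only [virial] at h ⊢
      rw [← powSum_rotate 3, ← powSum_rotate 1] at h
      simp only [Fin.reduceFinMk, x, y]
      linear_combination h
  linear_combination m * key

theorem sum_virial (H : M.IsNewtonian m μ J) (ht : t ∈ J) :
    virial (M.x 0 t) (M.y 0 t) (M.y 1 t) (M.y 2 t) + virial (M.x 1 t) (M.y 0 t) (M.y 1 t) (M.y 2 t)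
      + virial (M.x 2 t) (M.y 0 t) (M.y 1 t) (M.y 2 t) = -3 * μ := by
  have h := sum_gradPair (H.x_mul_y ht 0) (H.x_mul_y ht 1) (H.x_mul_y ht 2) (H.sum_x_sq ht)
  have h1 : powSum 1 (M.y 0 t) (M.y 1 t) (M.y 2 t) = μ := by simp [powSum, H.measure_eq t ht]
  simp only [gradPair, h1] at h
  linear_combination h - μ * H.sum_x_sq ht

/-- The Lagrange-Jacobi identity; a constant measure turns the potential into a function of `size`
alone. -/
theorem hasDerivAt_dilation (H : M.IsNewtonian m μ J) (ht : t ∈ J) :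
    HasDerivAt M.dilation (M.kinetic t - m * μ / M.size t) t := by
  refine ((((H.hasDerivAt_g ht 0).add (H.hasDerivAt_g ht 1)).add
    (H.hasDerivAt_g ht 2)).div_const 3).congr_deriv ?_
  have h := H.sum_virial ht
  simp only [kinetic]
  linear_combination m / M.size t / 3 * h

theorem hasDerivAt_angular (H : M.IsNewtonian m μ J) (ht : t ∈ J) :
    HasDerivAt M.angular 0 t := by
  have hh : ∀ i, HasDerivAt (M.h i) _ t := fun i =>
    ((H.hasDerivAt_a t ht i).mul (H.hasDerivAt_v t ht i)).sub
      ((H.hasDerivAt_b t ht i).mul (H.hasDerivAt_u t ht i))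
  refine ((((hh 0).add (hh 1)).add (hh 2)).div_const 3).congr_deriv ?_
  linear_combination m / 3 * ((M.b 0 t / M.r 0 t ^ 3 + M.b 1 t / M.r 1 t ^ 3
    + M.b 2 t / M.r 2 t ^ 3) * H.sum_a t ht - (M.a 0 t / M.r 0 t ^ 3 + M.a 1 t / M.r 1 t ^ 3
    + M.a 2 t / M.r 2 t ^ 3) * H.sum_b t ht)

/-- Conservation of energy. -/
theorem hasDerivAt_energy (H : M.IsNewtonian m μ J) (ht : t ∈ J) :
    HasDerivAt (fun s => M.kinetic s - 2 * (m * μ / M.size s)) 0 t := by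
  have hu : ∀ i, HasDerivAt (fun s => M.u i s ^ 2 + M.v i s ^ 2) _ t := fun i =>
    ((H.hasDerivAt_u t ht i).pow 2).add ((H.hasDerivAt_v t ht i).pow 2)
  have h := ((((hu 0).add (hu 1)).add (hu 2)).div_const 3).sub
    (((hasDerivAt_const t (m * μ)).div (H.hasDerivAt_size ht) (H.size_pos ht).ne').const_mul 2)
  refine h.congr_deriv ?_
  have h1 := H.sum_cube_mul_g ht
  have hR := H.size_pos ht
  have h2 : M.g 0 t / M.r 0 t ^ 3 + M.g 1 t / M.r 1 t ^ 3 + M.g 2 t / M.r 2 t ^ 3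
      = μ * M.dilation t / M.size t ^ 3 := by
    rw [← h1]
    simp only [y]
    have h3 := (H.r_pos ht 0).ne'
    have h4 := (H.r_pos ht 1).ne'
    have h5 := (H.r_pos ht 2).ne'
    field_simp
  have h6 : ∀ c : ℝ, (0 * c - m * μ * (M.dilation t / c)) / c ^ 2
      = -m * (μ * M.dilation t / c ^ 3) := by
    intro c
    by_cases hc : c = 0
    · simp [hc]
    · field_simp
      ring
  rw [h6, ← h2]
  simp only [g, Nat.cast_ofNat, Nat.add_one_sub_one, pow_one]
  linear_combination 2 * m / 3 * ((M.a 0 t / M.r 0 t ^ 3 + M.a 1 t / M.r 1 t ^ 3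
    + M.a 2 t / M.r 2 t ^ 3) * H.sum_u t ht + (M.b 0 t / M.r 0 t ^ 3 + M.b 1 t / M.r 1 t ^ 3
    + M.b 2 t / M.r 2 t ^ 3) * H.sum_v t ht)

theorem const_of_hasDerivAt_zero (H : M.IsNewtonian m μ J) {f : ℝ → ℝ}
    (hf : ∀ t ∈ J, HasDerivAt f 0 t) : ∃ c, ∀ t ∈ J, f t = c :=
  H.isOpen.exists_is_const_of_deriv_eq_zero H.isPreconnected
    (fun t ht => (hf t ht).differentiableAt.differentiableWithinAt) fun t ht => (hf t ht).deriv

/-- The integrals of motion: angular momentum `C`, twice the energy `E`, and the squared shape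
speed `K`. -/
theorem exists_integrals (H : M.IsNewtonian m μ J) :
    ∃ C E K : ℝ, ∀ t ∈ J, M.angular t = C ∧ M.size t ^ 2 * M.kinetic t
        = M.dilation t ^ 2 + C ^ 2 + K ∧
      M.dilation t ^ 2 = E * M.size t ^ 2 + 2 * m * μ * M.size t - (C ^ 2 + K) := by
  obtain ⟨C, hC⟩ := H.const_of_hasDerivAt_zero fun t ht => H.hasDerivAt_angular ht
  obtain ⟨E, hE⟩ := H.const_of_hasDerivAt_zero fun t ht => H.hasDerivAt_energy ht
  -- Its derivative vanishes by Lagrange-Jacobi and conservation of energy. The constant found here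
  -- still contains C², which is split off below.
  obtain ⟨K, hK⟩ := H.const_of_hasDerivAt_zero
    (f := fun s => E * M.size s ^ 2 + 2 * m * μ * M.size s - M.dilation s ^ 2) fun t ht => by
      refine (((((H.hasDerivAt_size ht).pow 2).const_mul E).add
        ((H.hasDerivAt_size ht).const_mul (2 * m * μ))).sub
        ((H.hasDerivAt_dilation ht).pow 2)).congr_deriv ?_
      have h1 := hE t ht
      have h2 := (H.size_pos ht).ne'
      simp only [Nat.cast_ofNat, Nat.add_one_sub_one, pow_one]
      rw [show M.kinetic t = E + 2 * (m * μ / M.size t) by linear_combination h1]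
      field_simp
      ring
  refine ⟨C, E, K - C ^ 2, fun t ht => ⟨hC t ht, ?_, ?_⟩⟩
  · have h1 := hE t ht
    have h2 := (H.size_pos ht).ne'
    rw [show M.kinetic t = E + 2 * (m * μ / M.size t) by linear_combination h1]
    have h3 := hK t ht
    field_simp
    linear_combination h3
  · linear_combination -hK t ht

end IsNewtonian
end SideMotion

end

/-! ### Shape equations along a motion of constant measure. -/

noncomputable section
open Polynomial
namespace SideMotion
namespace IsNewtonian

variable {M : SideMotion} {m μ : ℝ} {J : Set ℝ} {t : ℝ}

theorem measure_pos (H : M.IsNewtonian m μ J) (ht : t ∈ J) : 0 < μ := by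
  rw [← H.measure_eq t ht]
  have h := H.y_pos ht
  have := h 0
  have := h 1
  have := h 2
  positivity

theorem esymm_two_x (H : M.IsNewtonian m μ J) (ht : t ∈ J) :
    M.x 0 t * M.x 1 t + M.x 1 t * M.x 2 t + M.x 2 t * M.x 0 t
      = (M.perimeter t ^ 2 - 3) / 2 := by
  simp only [perimeter]
  linear_combination -H.sum_x_sq ht / 2

/-- The measure is the sum of the reciprocals of the normalized sides, that is, the quotient of
their second and third elementary symmetric functions. -/
theorem esymm_three_x (H : M.IsNewtonian m μ J) (ht : t ∈ J) :
    μ * (M.x 0 t * M.x 1 t * M.x 2 t) = (M.perimeter t ^ 2 - 3) / 2 := by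
  rw [← H.esymm_two_x ht, ← H.measure_eq t ht]
  linear_combination M.x 1 t * M.x 2 t * H.x_mul_y ht 0 + M.x 2 t * M.x 0 t * H.x_mul_y ht 1
    + M.x 0 t * M.x 1 t * H.x_mul_y ht 2

theorem perimeter_sq_sub_pos (H : M.IsNewtonian m μ J) (ht : t ∈ J) :
    0 < M.perimeter t ^ 2 - 3 := by
  have h := H.esymm_two_x ht
  have h0 := H.x_pos ht 0
  have h1 := H.x_pos ht 1
  have h2 := H.x_pos ht 2
  have : 0 < M.x 0 t * M.x 1 t + M.x 1 t * M.x 2 t + M.x 2 t * M.x 0 t := by positivity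
  linarith

theorem shapeRel (H : M.IsNewtonian m μ J) (ht : t ∈ J) :
    ShapeRel μ (M.perimeter t) (M.y 0 t) (M.y 1 t) (M.y 2 t) := by
  have e0 : M.x 0 t = (M.y 0 t)⁻¹ := eq_inv_of_mul_eq_one_left (H.x_mul_y ht 0)
  have e1 : M.x 1 t = (M.y 1 t)⁻¹ := eq_inv_of_mul_eq_one_left (H.x_mul_y ht 1)
  have e2 : M.x 2 t = (M.y 2 t)⁻¹ := eq_inv_of_mul_eq_one_left (H.x_mul_y ht 2)
  have h0 := (H.y_pos ht 0).ne'
  have h1 := (H.y_pos ht 1).ne'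
  have h2 := (H.y_pos ht 2).ne'
  have h3 := H.esymm_three_x ht
  have h4 : M.y 0 t * M.y 1 t * M.y 2 t * (M.perimeter t ^ 2 - 3) = 2 * μ := by
    rw [e0, e1, e2] at h3
    field_simp at h3
    linear_combination -h3
  refine ⟨H.measure_eq t ht, ?_, h4⟩
  have h5 : M.y 0 t * M.y 1 t + M.y 1 t * M.y 2 t + M.y 2 t * M.y 0 t
      = M.y 0 t * M.y 1 t * M.y 2 t * M.perimeter t := by
    rw [perimeter, e0, e1, e2]
    field_simp
    ring
  rw [h5]
  linear_combination M.perimeter t * h4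

/-- Heron's formula in terms of the elementary symmetric functions. -/
theorem area_sq (H : M.IsNewtonian m μ J) (ht : t ∈ J) :
    4 * M.area t ^ 2 * μ = M.perimeter t * (μ * M.perimeter t ^ 3 - 6 * μ * M.perimeter t
      - 4 * (M.perimeter t ^ 2 - 3)) := by
  have hR := (H.size_pos ht).ne'
  have h1 : 4 * M.area t ^ 2
      = 4 * M.x 0 t ^ 2 * M.x 1 t ^ 2 - (M.x 2 t ^ 2 - M.x 0 t ^ 2 - M.x 1 t ^ 2) ^ 2 := by
    simp only [area, x, div_pow]
    have ha : M.a 2 t = -M.a 0 t - M.a 1 t := by linear_combination H.sum_a t ht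
    have hb : M.b 2 t = -M.b 0 t - M.b 1 t := by linear_combination H.sum_b t ht
    rw [r_sq M 0, r_sq M 1, r_sq M 2, ha, hb]
    field_simp
    ring
  have h2 := H.esymm_two_x ht
  have h3 := H.esymm_three_x ht
  have h4 : 4 * M.area t ^ 2 = M.perimeter t * (-M.perimeter t ^ 3
      + 4 * (M.x 0 t * M.x 1 t + M.x 1 t * M.x 2 t + M.x 2 t * M.x 0 t) * M.perimeter t
      - 8 * (M.x 0 t * M.x 1 t * M.x 2 t)) := by
    rw [h1]
    simp only [perimeter]
    ring
  rw [h4, h2]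
  linear_combination -8 * M.perimeter t * h3

/-- The shape equations of a motion with constant measure, at a point that is not critical for
the measure. -/
theorem shape_equations (H : M.IsNewtonian m μ J) (ht : t ∈ J) {C K : ℝ}
    (hC : M.angular t = C)
    (hK : M.size t ^ 2 * M.kinetic t = M.dilation t ^ 2 + C ^ 2 + K)
    (hΓ : gradSq (M.y 0 t) (M.y 1 t) (M.y 2 t) ≠ 0) :
    ∃ σ s' : ℝ, HasDerivAt M.perimeter s' t ∧
      K = σ ^ 2 * gradSq (M.y 0 t) (M.y 1 t) (M.y 2 t) ∧
      m * M.size t * gradSq (M.y 0 t) (M.y 1 t) (M.y 2 t)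
        + 2 * C * σ * gradSq (M.y 0 t) (M.y 1 t) (M.y 2 t)
        + σ ^ 2 * levelHess (M.area t ^ 2) (M.y 0 t) (M.y 1 t) (M.y 2 t) = 0 ∧
      (M.size t ^ 2 * s') ^ 2
        = σ ^ 2 * perimeterSpeedSq (M.area t ^ 2) (M.y 0 t) (M.y 1 t) (M.y 2 t) := by
  have hR := (H.size_pos ht).ne'
  have hxy := H.x_mul_y ht
  have hμ : powSum 1 (M.y 0 t) (M.y 1 t) (M.y 2 t) = μ := by simp [powSum, H.measure_eq t ht]
  -- Sides are divided by `size` and velocities multiplied by it, so that their products remain g +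
  -- ih.
  let d : Fin 3 → ℂ := fun i => ⟨M.a i t / (M.size t), M.b i t / (M.size t)⟩
  let e : Fin 3 → ℂ := fun i => ⟨M.u i t * (M.size t), M.v i t * (M.size t)⟩
  have hde : ∀ i, (starRingEnd ℂ (d i) * e i) = ⟨M.g i t, M.h i t⟩ := by
    intro i
    apply Complex.ext
    · simp [d, e, g]
      field_simp
    · simp [d, e, h]
      field_simp
      ring
  have hdd : ∀ i, (starRingEnd ℂ (d i) * d i) = (M.x i t : ℂ) ^ 2 := by
    intro i
    have h1 := r_sq M i t
    have h2 : M.x i t ^ 2 = (M.a i t ^ 2 + M.b i t ^ 2) / M.size t ^ 2 := by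
      rw [x, div_pow, h1]
    rw [← Complex.ofReal_pow, h2]
    apply Complex.ext
    · simp only [d, Complex.mul_re, Complex.conj_re, Complex.conj_im, Complex.ofReal_re]
      ring
    · simp only [d, Complex.mul_im, Complex.conj_re, Complex.conj_im, Complex.ofReal_im]
      ring
  obtain ⟨σ, f₁, f₂, f₃, hT⟩ := velocity_decomposition (d₁ := d 0) (d₂ := d 1) (d₃ := d 2)
    (e₁ := e 0) (e₂ := e 1) (e₃ := e 2) (J := M.dilation t) (C := C)
    (T := (M.size t) ^ 2 * M.kinetic t) (w := M.area t)
    (by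
      apply Complex.ext
      · simp only [Complex.add_re, d, Complex.zero_re]
        linear_combination H.sum_a t ht / (M.size t)
      · simp only [Complex.add_im, d, Complex.zero_im]
        linear_combination H.sum_b t ht / (M.size t))
    (by
      apply Complex.ext
      · simp only [Complex.add_re, e, Complex.zero_re]
        linear_combination H.sum_u t ht * (M.size t)
      · simp only [Complex.add_im, e, Complex.zero_im]
        linear_combination H.sum_v t ht * (M.size t))
    (hxy 0) (hxy 1) (hxy 2) (H.sum_x_sq ht) (hdd 0) (hdd 1) (hdd 2)
    (by
      simp [d, area]
      field_simp
      ring)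
    (by simp only [hde, dilation]; ring)
    (by simp only [hde, ← hC, angular]; ring)
    (by simp only [Complex.normSq_apply, e, kinetic]; ring)
    (by simp only [hde, hμ]; linear_combination H.sum_cube_mul_g ht) hΓ
  have split : ∀ i : Fin 3, ∀ X G η : ℝ, starRingEnd ℂ (d i) * e i
      = (M.dilation t + Complex.I * C) * X ^ 2 + Complex.I * σ * (G + Complex.I * M.area t * η) →
      M.g i t = M.dilation t * X ^ 2 - σ * M.area t * η ∧ M.h i t = C * X ^ 2 + σ * G := by
    intro i X G η h
    rw [hde, ← Complex.ofReal_pow] at h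
    generalize X ^ 2 = Z at h ⊢
    have h1 := congrArg Complex.re h
    have h2 := congrArg Complex.im h
    simp at h1 h2
    constructor
    · linear_combination h1
    · linear_combination h2
  obtain ⟨g₁, h₁⟩ := split 0 _ _ (M.y 1 t ^ 3 - M.y 2 t ^ 3) (by push_cast; exact f₁)
  obtain ⟨g₂, h₂⟩ := split 1 _ _ (M.y 2 t ^ 3 - M.y 0 t ^ 3) (by push_cast; exact f₂)
  obtain ⟨g₃, h₃⟩ := split 2 _ _ (M.y 0 t ^ 3 - M.y 1 t ^ 3) (by push_cast; exact f₃)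
  refine ⟨σ, _, ((H.hasDerivAt_x ht 0).add (H.hasDerivAt_x ht 1)).add (H.hasDerivAt_x ht 2),
    by linear_combination hT - hK, ?_, ?_⟩
  · refine level_curvature_equation (hxy 0) (hxy 1) (hxy 2) g₁ g₂ g₃ h₁ h₂ h₃ hT ?_
    rw [hμ]
    -- Second order stationarity: the first order identity is differentiated once more.
    have hd : HasDerivAt (fun s => M.y 0 s ^ 3 * M.g 0 s + M.y 1 s ^ 3 * M.g 1 s
        + M.y 2 s ^ 3 * M.g 2 s - μ * M.dilation s) 0 t := by
      refine (hasDerivAt_const t (0 : ℝ)).congr_of_eventuallyEq ?_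
      filter_upwards [H.isOpen.mem_nhds ht] with s hs
      rw [H.sum_cube_mul_g hs, sub_self]
    have hi := fun i => ((H.hasDerivAt_y ht i).pow 3).mul (H.hasDerivAt_g ht i)
    have hd' := (((hi 0).add (hi 1)).add (hi 2)).sub ((H.hasDerivAt_dilation ht).const_mul μ)
    have h0 := hd'.unique hd
    have hvel : ∀ i, M.u i t ^ 2 + M.v i t ^ 2
        = M.y i t ^ 2 * (M.g i t ^ 2 + M.h i t ^ 2) / (M.size t) ^ 2 := by
      intro i
      have h1 : M.g i t ^ 2 + M.h i t ^ 2 = M.r i t ^ 2 * (M.u i t ^ 2 + M.v i t ^ 2) := by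
        rw [r_sq M i t]
        simp only [g, h]
        ring
      have h2 := (H.r_pos ht i).ne'
      rw [h1]
      simp only [y]
      field_simp
    rw [hvel 0, hvel 1, hvel 2] at h0
    simp only [Pi.pow_apply, Nat.cast_ofNat, Nat.add_one_sub_one] at h0
    field_simp at h0
    linear_combination h0
  · rw [g₁, g₂, g₃]
    simp only [perimeterSpeedSq]
    -- The dilation drops out of the perimeter speed because x²y = x.
    have hx : ∀ i, M.dilation t * M.x i t ^ 2 * M.y i t = M.dilation t * M.x i t := by
      intro i
      linear_combination M.dilation t * M.x i t * hxy i
    rw [mul_comm ((M.size t) ^ 2)]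
    field_simp
    have key : ∀ p q : ℝ, p = -q → p ^ 2 = q ^ 2 := by rintro p q rfl; ring
    rw [← mul_pow, ← mul_pow]
    apply key
    linear_combination hx 0 + hx 1 + hx 2

end IsNewtonian
end SideMotion

end

/-! ### The differential equation in the perimeter, and constancy of the shape. -/

noncomputable section
open Polynomial Filter Topology
namespace SideMotion
namespace IsNewtonian

variable {M : SideMotion} {m μ : ℝ} {J : Set ℝ} {t : ℝ}

/-- The first order differential equation for the size as an algebraic function of the
normalized perimeter. -/
theorem size_ode (H : M.IsNewtonian m μ J) (ht : t ∈ J) {C E K : ℝ}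
    (hI : ∀ t ∈ J, M.angular t = C ∧ M.size t ^ 2 * M.kinetic t = M.dilation t ^ 2 + C ^ 2 + K ∧
      M.dilation t ^ 2 = E * M.size t ^ 2 + 2 * m * μ * M.size t - (C ^ 2 + K))
    {N δ L D B : ℝ[X]} (hD : D = X ^ 2 - 3) (hB : B = Polynomial.C K * L * D)
    (hpoly : ∀ s W y₁ y₂ y₃, ShapeRel μ s y₁ y₂ y₃ →
        4 * W * μ = s * (μ * s ^ 3 - 6 * μ * s - 4 * (s ^ 2 - 3)) →
        gradSq y₁ y₂ y₃ * (s ^ 2 - 3) ^ 3 = N.eval s ∧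
        perimeterSpeedSq W y₁ y₂ y₃ * (s ^ 2 - 3) ^ 3 = δ.eval s ∧
        levelHess W y₁ y₂ y₃ * (s ^ 2 - 3) ^ 5 = L.eval s)
    {s : ℝ} (hs : s = M.perimeter t) (hN : N.eval s ≠ 0) :
    ∃ η : ℝ, η ^ 2 = C ^ 2 * K * (D.eval s * N.eval s) ∧
      2 * D.eval s * N.eval s * η + B.eval s = -m * M.size t * N.eval s ^ 2 ∧
      K * δ.eval s * N.eval s * ((N.eval s * (3 * (derivative D).eval s * N.eval s
          - D.eval s * (derivative N).eval s)) * η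
          + ((derivative B).eval s * N.eval s - 2 * B.eval s * (derivative N).eval s)) ^ 2
        = (2 * D.eval s * N.eval s * η + B.eval s) ^ 2 *
          (E / m ^ 2 * (2 * D.eval s * N.eval s * η + B.eval s) ^ 2
            + -2 * μ * N.eval s ^ 2 * (2 * D.eval s * N.eval s * η + B.eval s)
            + -(C ^ 2 + K) * N.eval s ^ 4) := by
  have hDe : ∀ x, D.eval x = x ^ 2 - 3 := fun x => by simp [hD]
  have hm := H.mass_pos.ne'
  -- the algebraic relation between size and perimeter
  have rel : ∀ τ ∈ J, N.eval (M.perimeter τ) ≠ 0 →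
      ((-m * M.size τ * N.eval (M.perimeter τ) ^ 2 - B.eval (M.perimeter τ))
        / (2 * D.eval (M.perimeter τ) * N.eval (M.perimeter τ))) ^ 2
        = C ^ 2 * K * (D.eval (M.perimeter τ) * N.eval (M.perimeter τ)) ∧
      ∃ s', HasDerivAt M.perimeter s' τ ∧ N.eval (M.perimeter τ) * (M.size τ ^ 2 * s') ^ 2
        = K * δ.eval (M.perimeter τ) := by
    intro τ hτ hNτ
    obtain ⟨hC, hK, -⟩ := hI τ hτ
    obtain ⟨h1, h2, h3⟩ := hpoly _ _ _ _ _ (H.shapeRel hτ) (H.area_sq hτ)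
    have hDτ := (H.perimeter_sq_sub_pos hτ).ne'
    have hΓ : gradSq (M.y 0 τ) (M.y 1 τ) (M.y 2 τ) ≠ 0 := by
      intro h
      rw [h, zero_mul] at h1
      exact hNτ h1.symm
    obtain ⟨σ, s', e1, e2, e3, e4⟩ := H.shape_equations hτ hC hK hΓ
    refine ⟨?_, s', e1, ?_⟩
    · simp only [hB, eval_mul, eval_C, hDe, ← h1, ← h3]
      generalize gradSq (M.y 0 τ) (M.y 1 τ) (M.y 2 τ) = Γ at *
      generalize levelHess (M.area τ ^ 2) (M.y 0 τ) (M.y 1 τ) (M.y 2 τ) = Θ at *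
      generalize M.perimeter τ ^ 2 - 3 = d at *
      -- The curvature equation shows that η is CσΓd², whose square is C²K·d·(Γd³).
      have e5 : -m * M.size τ * (Γ * d ^ 3) ^ 2 - K * (Θ * d ^ 5) * d
          = 2 * d * (Γ * d ^ 3) * (C * σ * Γ * d ^ 2) := by
        rw [e2]
        linear_combination -Γ * d ^ 6 * e3
      rw [e5, mul_div_assoc, mul_comm, div_mul_cancel₀ _ (by positivity), e2]
      ring
    · rw [e4, e2, ← h1, ← h2]
      ring
  have hNt : N.eval (M.perimeter t) ≠ 0 := hs ▸ hN
  obtain ⟨r1, s', hs', r2⟩ := rel t ht hNt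
  obtain ⟨-, -, hJ⟩ := hI t ht
  have hev : ∀ p : ℝ[X], HasDerivAt (fun τ => p.eval (M.perimeter τ))
      ((derivative p).eval (M.perimeter t) * s') t := fun p =>
    (p.hasDerivAt (M.perimeter t)).comp t hs'
  have hnear : ∀ᶠ τ in 𝓝 t, τ ∈ J ∧ N.eval (M.perimeter τ) ≠ 0 :=
    (H.isOpen.eventually_mem ht).and ((hev N).continuousAt.eventually_ne hNt)
  have hDt : D.eval (M.perimeter t) ≠ 0 := by
    rw [hDe]
    exact (H.perimeter_sq_sub_pos ht).ne'
  have hS := (((hasDerivAt_const t (-m)).mul (H.hasDerivAt_size ht)).mul ((hev N).pow 2))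
  have hη := (hS.sub (hev B)).div (((hev D).const_mul 2).mul (hev N))
    (mul_ne_zero (mul_ne_zero two_ne_zero hDt) hNt)
  set η : ℝ → ℝ := fun τ => (-m * M.size τ * N.eval (M.perimeter τ) ^ 2 - B.eval (M.perimeter τ))
        / (2 * D.eval (M.perimeter τ) * N.eval (M.perimeter τ)) with hηdef
  obtain ⟨η', hη'⟩ : ∃ η', HasDerivAt η η' t := ⟨_, hη⟩
  have hsq := (hη'.pow 2).unique <|
    (((hev D).mul (hev N)).const_mul (C ^ 2 * K)).congr_of_eventuallyEq <| by
      filter_upwards [hnear] with τ hτ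
      exact (rel τ hτ.1 hτ.2).1
  have hval : ∀ τ ∈ J, N.eval (M.perimeter τ) ≠ 0 →
      2 * D.eval (M.perimeter τ) * N.eval (M.perimeter τ) * η τ + B.eval (M.perimeter τ)
        = -m * M.size τ * N.eval (M.perimeter τ) ^ 2 := by
    intro τ hτ hNτ
    have hDτ : D.eval (M.perimeter τ) ≠ 0 := by
      rw [hDe]
      exact (H.perimeter_sq_sub_pos hτ).ne'
    simp only [hηdef]
    rw [mul_div_cancel₀ _ (mul_ne_zero (mul_ne_zero two_ne_zero hDτ) hNτ)]
    ring
  have hlin := hS.unique <|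
    (((((hev D).const_mul 2).mul (hev N)).mul hη').add (hev B)).congr_of_eventuallyEq <| by
      filter_upwards [hnear] with τ hτ
      exact (hval τ hτ.1 hτ.2).symm
  have hv := hval t ht hNt
  have hR := (H.size_pos ht).ne'
  refine ⟨η t, ?_, ?_, ?_⟩
  · rw [hs]; exact r1
  · rw [hs]; exact hv
  · change η t ^ 2 = _ at r1
    rw [hs]
    simp only [Pi.mul_apply, Pi.pow_apply, Nat.cast_ofNat, Nat.add_one_sub_one, pow_one] at hsq hlin
    generalize N.eval (M.perimeter t) = n at *
    generalize D.eval (M.perimeter t) = d at *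
    generalize B.eval (M.perimeter t) = b at *
    generalize δ.eval (M.perimeter t) = e at *
    generalize (derivative N).eval (M.perimeter t) = n' at *
    generalize (derivative D).eval (M.perimeter t) = d' at *
    generalize (derivative B).eval (M.perimeter t) = b' at *
    generalize M.size t = R at *
    generalize M.dilation t = j at *
    generalize η t = w at *
    -- Differentiating η² = αDN requires division by η. If η vanishes at `t`, then α = 0 and η
    -- vanishes near `t`.
    have hw : 2 * (d * n) * η' = (d' * n + d * n') * w * s' := by
      by_cases h0 : w = 0
      · subst h0
        have hα : C ^ 2 * K = 0 := by
          have : C ^ 2 * K * (d * n) = 0 := by rw [← r1]; ring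
          exact (mul_eq_zero.1 this).resolve_right (mul_ne_zero hDt hNt)
        have hηz : η' = 0 := by
          refine hη'.unique ((hasDerivAt_const t (0 : ℝ)).congr_of_eventuallyEq ?_)
          filter_upwards [hnear] with τ hτ
          have h := (rel τ hτ.1 hτ.2).1
          rw [hα, zero_mul] at h
          exact pow_eq_zero_iff (two_ne_zero) |>.1 h
        rw [hηz]
        ring
      · apply mul_left_cancel₀ h0
        linear_combination (d * n) * hsq - (d' * n + d * n') * s' * r1
    -- This is N dS - 2S dN for S = -mRN²: only the derivative of R survives.
    have hT : ((n * (3 * d' * n - d * n')) * w + (b' * n - 2 * b * n')) * s'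
        = -m * n ^ 3 * (j / R) := by
      linear_combination -n * hlin - n * hw - 2 * n' * s' * hv
    rw [hv]
    have hs0 : K * e * n * (((n * (3 * d' * n - d * n')) * w + (b' * n - 2 * b * n'))) ^ 2
        = (n * (R ^ 2 * (((n * (3 * d' * n - d * n')) * w + (b' * n - 2 * b * n')) * s'))) ^ 2 := by
      linear_combination -n * (((n * (3 * d' * n - d * n')) * w + (b' * n - 2 * b * n'))) ^ 2 * r2
    rw [hs0, hT]
    field_simp
    linear_combination hJ

/-- The normalized perimeter is constant along a motion with constant measure. -/
theorem perimeter_const (H : M.IsNewtonian m μ J) : ∃ c, ∀ t ∈ J, M.perimeter t = c := by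
  obtain ⟨C, E, K, hI⟩ := H.exists_integrals
  refine H.const_of_hasDerivAt_zero ?_
  by_contra! hcon
  obtain ⟨t₀, ht₀, hne⟩ := hcon
  obtain ⟨N, δ, L, hN, hδ, hpoly⟩ := exists_shape_polynomials (H.measure_pos ht₀).ne'
  set p' : ℝ → ℝ := fun t => (M.g 0 t * M.y 0 t - M.dilation t * M.x 0 t) / M.size t ^ 2
    + (M.g 1 t * M.y 1 t - M.dilation t * M.x 1 t) / M.size t ^ 2
    + (M.g 2 t * M.y 2 t - M.dilation t * M.x 2 t) / M.size t ^ 2 with hp'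
  have hder : ∀ t ∈ J, HasDerivAt M.perimeter (p' t) t := fun t ht =>
    ((H.hasDerivAt_x ht 0).add (H.hasDerivAt_x ht 1)).add (H.hasDerivAt_x ht 2)
  have hp0 : p' t₀ ≠ 0 := fun h => hne (h ▸ hder t₀ ht₀)
  have hpc : ContinuousAt p' t₀ := by
    have hc : ∀ i, ContinuousAt
        (fun t => (M.g i t * M.y i t - M.dilation t * M.x i t) / M.size t ^ 2) t₀ := fun i =>
      (((H.hasDerivAt_g ht₀ i).continuousAt.mul (H.hasDerivAt_y ht₀ i).continuousAt).sub
        ((H.hasDerivAt_dilation ht₀).continuousAt.mul (H.hasDerivAt_x ht₀ i).continuousAt)).div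
        ((H.hasDerivAt_size ht₀).continuousAt.pow 2) (pow_ne_zero 2 (H.size_pos ht₀).ne')
    exact ((hc 0).add (hc 1)).add (hc 2)
  have hN0 : N ≠ 0 := by rintro rfl; simp at hN
  have hfin : {s : ℝ | N.IsRoot s}.Finite := finite_setOfPred_isRoot hN0
  -- The perimeter has nonzero speed at `t₀`, so it avoids the finitely many roots of `N` at nearby
  -- times.
  have hroots : ∀ᶠ t in 𝓝[≠] t₀, N.eval (M.perimeter t) ≠ 0 := by
    have h : ∀ᶠ t in 𝓝[≠] t₀, ∀ c ∈ {s : ℝ | N.IsRoot s}, M.perimeter t ≠ c :=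
      (eventually_all_finite hfin).2 fun c _ => (hder t₀ ht₀).eventually_ne hp0
    filter_upwards [h] with t ht h0
    exact ht _ h0 rfl
  -- If K = 0, the shape speed σ vanishes off the roots of `N`, and with it the perimeter speed.
  have hK : K ≠ 0 := by
    rintro rfl
    obtain ⟨t, h1, h2, h3⟩ := (hroots.and (((H.isOpen.eventually_mem ht₀).and
      (hpc.eventually_ne hp0)).filter_mono nhdsWithin_le_nhds)).exists
    obtain ⟨hC, hK, -⟩ := hI t h2
    have hΓ : gradSq (M.y 0 t) (M.y 1 t) (M.y 2 t) ≠ 0 := by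
      intro h
      have h4 := (hpoly _ _ _ _ _ (H.shapeRel h2) (H.area_sq h2)).1
      rw [h, zero_mul] at h4
      exact h1 h4.symm
    obtain ⟨σ, s', e1, e2, -, e4⟩ := H.shape_equations h2 hC hK hΓ
    have hσ : σ = 0 := by
      have := (mul_eq_zero.1 e2.symm).resolve_right hΓ
      exact pow_eq_zero_iff two_ne_zero |>.1 this
    rw [hσ, e1.unique (hder t h2)] at e4
    have h5 : M.size t ^ 2 * p' t = 0 := by
      apply pow_eq_zero_iff two_ne_zero |>.1
      rw [e4]
      ring
    rcases mul_eq_zero.1 h5 with h6 | h6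
    · exact (pow_ne_zero 2 (H.size_pos h2).ne') h6
    · exact h3 h6
  set Z : Set ℝ := (M.perimeter '' J) \ {s : ℝ | N.IsRoot s} with hZ
  have hZinf : Z.Infinite := by
    refine Set.Infinite.sdiff ?_ hfin
    refine (H.isPreconnected.image _ fun t ht =>
      (hder t ht).continuousAt.continuousWithinAt).infinite_of_nontrivial ?_
    obtain ⟨t, h1, h2⟩ := (((hder t₀ ht₀).eventually_ne hp0 (c := M.perimeter t₀)).and
      ((H.isOpen.eventually_mem ht₀).filter_mono nhdsWithin_le_nhds)).exists
    exact ⟨_, ⟨t, h2, rfl⟩, _, ⟨t₀, ht₀, rfl⟩, h1⟩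
  have h3 : (√3 : ℝ) ^ 2 = 3 := Real.sq_sqrt (by norm_num)
  have key : ∀ s ∈ Z, ∃ t ∈ J, s = M.perimeter t ∧ N.eval s ≠ 0 := by
    rintro _ ⟨⟨t, ht, rfl⟩, h⟩
    exact ⟨t, ht, rfl, h⟩
  obtain ⟨hα, hB⟩ := algebraic_ode_trivial (D := X ^ 2 - 3) (N := N) (δ := δ)
    (B := Polynomial.C K * L * (X ^ 2 - 3)) (a := √3) (α := C ^ 2 * K) (k := K) (h := E / m ^ 2)
    (g := -2 * μ) (c := -(C ^ 2 + K)) (by simp [h3]) (by simp [derivative_pow]) hN hδ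
    (by simp [h3]) hK hZinf (fun s hs => by
      obtain ⟨t, ht, hst, hNs⟩ := key s hs
      obtain ⟨η, h1, -, h2⟩ := H.size_ode ht hI rfl rfl hpoly hst hNs
      exact ⟨η, h1, h2⟩)
  obtain ⟨s, hs⟩ := hZinf.nonempty
  obtain ⟨t, ht, hst, hNs⟩ := key s hs
  obtain ⟨η, h1, h2, -⟩ := H.size_ode ht hI rfl rfl hpoly hst hNs
  have hη : η = 0 := by
    rw [hα, zero_mul] at h1
    exact pow_eq_zero_iff two_ne_zero |>.1 h1
  rw [hη, hB] at h2
  have h4 : -m * M.size t * N.eval s ^ 2 = 0 := by rw [← h2]; simp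
  have := H.mass_pos.ne'
  have := (H.size_pos ht).ne'
  simp_all

/-- The normalized side lengths are constant along a motion with constant measure. -/
theorem x_const (H : M.IsNewtonian m μ J) (i : Fin 3) :
    ∀ t ∈ J, ∀ t' ∈ J, M.x i t = M.x i t' := by
  obtain ⟨s, hs⟩ := H.perimeter_const
  -- The cubic whose roots are the three normalized sides; its coefficients depend only on `s` and
  -- `μ`.
  set P : ℝ[X] := X ^ 3 - Polynomial.C s * X ^ 2 + Polynomial.C ((s ^ 2 - 3) / 2) * X
    - Polynomial.C ((s ^ 2 - 3) / (2 * μ)) with hP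
  have hP0 : P ≠ 0 := by
    have : P.coeff 3 = 1 := by simp [hP]
    intro h
    simp [h] at this
  have hroot : M.x i '' J ⊆ {x : ℝ | P.IsRoot x} := by
    rintro _ ⟨t, ht, rfl⟩
    have h2 := H.esymm_two_x ht
    have h3 := H.esymm_three_x ht
    have hμ := (H.measure_pos ht).ne'
    have hp := hs t ht
    rw [hp] at h2 h3
    have h4 : (s ^ 2 - 3) / (2 * μ) = M.x 0 t * M.x 1 t * M.x 2 t := by
      field_simp
      linear_combination -2 * h3
    change P.eval _ = 0
    simp only [hP, eval_sub, eval_add, eval_mul, eval_pow, eval_X, eval_C]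
    rw [h4, ← h2, ← hp, perimeter]
    fin_cases i <;> simp <;> ring
  have hsub : (M.x i '' J).Subsingleton := by
    by_contra h
    rw [Set.not_subsingleton_iff] at h
    exact ((H.isPreconnected.image _ fun t ht =>
      (H.hasDerivAt_x ht i).continuousAt.continuousWithinAt).infinite_of_nontrivial h)
      ((finite_setOfPred_isRoot hP0).subset hroot)
  exact fun t ht t' ht' => hsub ⟨t, ht, rfl⟩ ⟨t', ht', rfl⟩

end IsNewtonian
end SideMotion

end

/-! ### Similarity of centred triangles in the plane. -/

noncomputable section

theorem norm_sq_plane (x : Plane) : ‖x‖ ^ 2 = x 0 ^ 2 + x 1 ^ 2 := by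
  rw [EuclideanSpace.real_norm_sq_eq, Fin.sum_univ_two]

/-- The squared norm of a combination of three vectors with zero sum in terms of the mutual
distances. -/
theorem norm_sq_combination {x : Fin 3 → Plane} (hx : ∑ k, x k = 0) (c : Fin 3 → ℝ) :
    ‖∑ k, c k • x k‖ ^ 2
      = -((c 0 - (c 0 + c 1 + c 2) / 3) * (c 1 - (c 0 + c 1 + c 2) / 3) * ‖x 0 - x 1‖ ^ 2
        + (c 1 - (c 0 + c 1 + c 2) / 3) * (c 2 - (c 0 + c 1 + c 2) / 3) * ‖x 1 - x 2‖ ^ 2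
        + (c 2 - (c 0 + c 1 + c 2) / 3) * (c 0 - (c 0 + c 1 + c 2) / 3) * ‖x 2 - x 0‖ ^ 2) := by
  -- Subtracting the mean of `c` does not change the combination, since the vectors sum to zero.
  rw [Fin.sum_univ_three] at hx ⊢
  have h : x 2 = -x 0 - x 1 := by
    rw [← sub_eq_zero, ← hx]
    abel
  simp only [h, norm_sq_plane, PiLp.add_apply, PiLp.sub_apply, PiLp.smul_apply, PiLp.neg_apply,
    smul_eq_mul]
  ring

/-- Two centred triangles with proportional sides are related by a similarity fixing the
origin. -/
theorem exists_isometry_of_proportional {x z : Fin 3 → Plane} {l : ℝ} (hl : 0 < l)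
    (hx : ∑ k, x k = 0) (hz : ∑ k, z k = 0) (h01 : ‖z 0 - z 1‖ = l * ‖x 0 - x 1‖)
    (h12 : ‖z 1 - z 2‖ = l * ‖x 1 - x 2‖) (h20 : ‖z 2 - z 0‖ = l * ‖x 2 - x 0‖) :
    ∃ Ω : Plane ≃ₗᵢ[ℝ] Plane, ∀ k, z k = l • Ω (x k) := by
  let F : (Fin 3 → Plane) → (Fin 3 → ℝ) →ₗ[ℝ] Plane := fun w => Fintype.linearCombination ℝ w
  have hF : ∀ w c, F w c = ∑ k, c k • w k := fun w c => Fintype.linearCombination_apply ℝ w c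
  have hnorm : ∀ c, ‖F z c‖ = l * ‖F x c‖ := by
    intro c
    have h : ‖F z c‖ ^ 2 = (l * ‖F x c‖) ^ 2 := by
      rw [mul_pow, hF, hF, norm_sq_combination hx, norm_sq_combination hz, h01, h12, h20]
      ring
    exact (sq_eq_sq₀ (norm_nonneg _) (by positivity)).1 h
  have hker : LinearMap.ker (F x) ≤ LinearMap.ker (F z) := by
    intro c hc
    rw [LinearMap.mem_ker] at hc ⊢
    rw [← norm_eq_zero, hnorm, hc, norm_zero, mul_zero]
  -- The map is defined on the span of the `x k` and later extended to the plane, so collinear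
  -- triangles need no separate treatment.
  let f : LinearMap.range (F x) →ₗ[ℝ] Plane :=
    l⁻¹ • ((LinearMap.ker (F x)).liftQ (F z) hker ∘ₗ (F x).quotKerEquivRange.symm.toLinearMap)
  have hf : ∀ c, f ⟨F x c, LinearMap.mem_range_self _ c⟩ = l⁻¹ • F z c := by
    intro c
    have h : (F x).quotKerEquivRange.symm ⟨F x c, LinearMap.mem_range_self _ c⟩
        = (LinearMap.ker (F x)).mkQ c := (F x).quotKerEquivRange_symm_apply_image c _
    simp [f, h]
  let fi : LinearMap.range (F x) →ₗᵢ[ℝ] Plane :=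
    { f with
      norm_map' := by
        rintro ⟨_, c, rfl⟩
        change ‖f ⟨F x c, _⟩‖ = ‖F x c‖
        rw [hf, norm_smul, hnorm, norm_inv, Real.norm_of_nonneg hl.le,
          inv_mul_cancel_left₀ hl.ne'] }
  refine ⟨fi.extend.toLinearIsometryEquiv rfl, fun k => ?_⟩
  have hk : ∀ w : Fin 3 → Plane, F w (Pi.single k 1) = w k := by
    intro w
    rw [hF]
    simp [Pi.single_apply]
  have h : fi.extend (x k) = l⁻¹ • z k := by
    calc fi.extend (x k) = fi.extend (F x (Pi.single k 1)) := by rw [hk]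
      _ = f ⟨F x (Pi.single k 1), LinearMap.mem_range_self _ _⟩ :=
        fi.extend_apply ⟨F x (Pi.single k 1), LinearMap.mem_range_self _ _⟩
      _ = l⁻¹ • F z (Pi.single k 1) := hf _
      _ = l⁻¹ • z k := by rw [hk]
  simp only [LinearIsometry.coe_toLinearIsometryEquiv, h]
  rw [smul_inv_smul₀ hl.ne']

end

/-! ### From a three-body solution to its moving sides. -/

noncomputable section

/-- The sides of the triangle formed by three bodies with masses `m`. -/
def sideMotion (m : Fin 3 → ℝ) (q p : ℝ → Fin 3 → Plane) : SideMotion where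
  -- Side `i` lies opposite body `i`. Indices are cyclic modulo 3, so the sides sum to zero.
  a i t := q t (i + 1) 0 - q t (i + 2) 0
  b i t := q t (i + 1) 1 - q t (i + 2) 1
  u i t := (m (i + 1))⁻¹ * p t (i + 1) 0 - (m (i + 2))⁻¹ * p t (i + 2) 0
  v i t := (m (i + 1))⁻¹ * p t (i + 1) 1 - (m (i + 2))⁻¹ * p t (i + 2) 1

theorem sideMotion_r (m : Fin 3 → ℝ) (q p : ℝ → Fin 3 → Plane) (i : Fin 3) (t : ℝ) :
    (sideMotion m q p).r i t = ‖q t (i + 1) - q t (i + 2)‖ := by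
  rw [SideMotion.r, Real.sqrt_eq_iff_mul_self_eq (by positivity) (norm_nonneg _), ← pow_two,
    norm_sq_plane]
  simp [sideMotion]

theorem HasDerivAt.plane_apply {f : ℝ → Plane} {f' : Plane} {t : ℝ} (h : HasDerivAt f f' t)
    (c : Fin 2) : HasDerivAt (fun s => f s c) (f' c) t :=
  (EuclideanSpace.proj (𝕜 := ℝ) c).hasFDerivAt.comp_hasDerivAt t h

theorem force_apply {m : Fin 3 → ℝ} {M : ℝ} (hm : ∀ k, m k = M) (hM : M ≠ 0)
    (x : Fin 3 → Plane) (k : Fin 3) (c : Fin 2) :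
    M⁻¹ * force m x k c = M * ((x (k + 1) c - x k c) / ‖x (k + 1) - x k‖ ^ 3
      + (x (k + 2) c - x k c) / ‖x (k + 2) - x k‖ ^ 3) := by
  have h : Finset.univ.erase k = {k + 1, k + 2} := by decide +revert
  have h' : k + 1 ≠ k + 2 := by decide +revert
  rw [force, h, Finset.sum_pair h']
  simp only [hm, PiLp.add_apply, PiLp.smul_apply, PiLp.sub_apply, smul_eq_mul]
  field_simp

theorem sum_norm_sq_of_centred {x : Fin 3 → Plane} (hx : ∑ k, x k = 0) :
    ∑ k, ‖x k‖ ^ 2 = (‖x 1 - x 2‖ ^ 2 + ‖x 2 - x 0‖ ^ 2 + ‖x 0 - x 1‖ ^ 2) / 3 := by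
  rw [Fin.sum_univ_three] at hx ⊢
  have h : x 2 = -x 0 - x 1 := by
    rw [← sub_eq_zero, ← hx]
    abel
  simp only [h, norm_sq_plane, PiLp.sub_apply, PiLp.neg_apply]
  ring

theorem IsSolution.isNewtonian {m : Fin 3 → ℝ} {M : ℝ} (hm : ∀ k, m k = M) (hM : 0 < M)
    {J : Set ℝ} {q p : ℝ → Fin 3 → Plane} (hsol : IsSolution m J q p)
    (hmeasure : ∃ μ : ℝ, ∀ t ∈ J, configMeasure m (q t) = μ) :
    ∃ μ, (sideMotion m q p).IsNewtonian M μ J := by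
  obtain ⟨μ, hμ⟩ := hmeasure
  have hM0 := hM.ne'
  have hdist : ∀ t ∈ J, ∀ i : Fin 3, 0 < ‖q t (i + 1) - q t (i + 2)‖ := by
    intro t ht i
    rw [norm_pos_iff, sub_ne_zero]
    intro h
    have hne : ∀ i : Fin 3, i + 1 ≠ i + 2 := by decide
    exact hne i (hsol.noCollision t ht h)
  have hq : ∀ t ∈ J, ∀ k c, HasDerivAt (fun s => q s k c) ((m k)⁻¹ * p t k c) t := by
    intro t ht k c
    have h := (hsol.hasDerivAt_q t ht k).plane_apply c
    simpa using h
  have hp : ∀ t ∈ J, ∀ k c, HasDerivAt (fun s => (m k)⁻¹ * p s k c)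
      (M * ((q t (k + 1) c - q t k c) / ‖q t (k + 1) - q t k‖ ^ 3
      + (q t (k + 2) c - q t k c) / ‖q t (k + 2) - q t k‖ ^ 3)) t := by
    intro t ht k c
    rw [← force_apply hm hM0]
    have h := ((hsol.hasDerivAt_p t ht k).plane_apply c).const_mul (m k)⁻¹
    rwa [hm k] at h ⊢
  have hacc : ∀ t ∈ J, ∀ i : Fin 3, ∀ c, HasDerivAt
      (fun s => (m (i + 1))⁻¹ * p s (i + 1) c - (m (i + 2))⁻¹ * p s (i + 2) c)
      (M * ((q t 1 c - q t 2 c) / ‖q t 1 - q t 2‖ ^ 3 + (q t 2 c - q t 0 c) / ‖q t 2 - q t 0‖ ^ 3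
        + (q t 0 c - q t 1 c) / ‖q t 0 - q t 1‖ ^ 3
        - 3 * ((q t (i + 1) c - q t (i + 2) c) / ‖q t (i + 1) - q t (i + 2)‖ ^ 3))) t := by
    intro t ht i c
    refine ((hp t ht (i + 1) c).sub (hp t ht (i + 2) c)).congr_deriv ?_
    have h01 := norm_sub_rev (q t 1) (q t 0)
    have h12 := norm_sub_rev (q t 2) (q t 1)
    have h20 := norm_sub_rev (q t 0) (q t 2)
    fin_cases i
    · simp [h12, h20]
      ring
    · simp [h01, h20]
      ring
    · simp [h01, h12]
      ring
  -- The masses contribute M² to the potential and √M to the square root of the moment of inertia.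
  refine ⟨μ / (M ^ 2 * √M), hsol.isOpen, hsol.ordConnected.isPreconnected, hM, ?_, ?_, ?_, ?_, ?_,
    ?_, ?_, ?_, ?_, ?_⟩
  · intro t _; simp [sideMotion]
  · intro t _; simp [sideMotion]
  · intro t _; simp [sideMotion]
  · intro t _; simp [sideMotion]
  · intro t ht i
    have h := hdist t ht i
    rw [← sideMotion_r m q p] at h
    exact Real.sqrt_pos.1 h
  · intro t ht i
    exact (hq t ht (i + 1) 0).sub (hq t ht (i + 2) 0)
  · intro t ht i
    exact (hq t ht (i + 1) 1).sub (hq t ht (i + 2) 1)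
  · intro t ht i
    simp only [sideMotion_r]
    exact hacc t ht i 0
  · intro t ht i
    simp only [sideMotion_r]
    exact hacc t ht i 1
  · intro t ht
    have hcm : ∑ k, q t k = 0 := by
      have h := hsol.centreOfMass t ht
      simp only [hm, ← Finset.smul_sum] at h
      exact (smul_eq_zero.1 h).resolve_left hM0
    have hI : momentOfInertia m (q t) = M * (sideMotion m q p).size t ^ 2 := by
      rw [SideMotion.IsNewtonian.size_sq, momentOfInertia]
      simp only [hm, ← Finset.mul_sum, sum_norm_sq_of_centred hcm, sideMotion_r]
      rfl
    have hU : potential m (q t) = M ^ 2 * (1 / (sideMotion m q p).r 0 t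
        + 1 / (sideMotion m q p).r 1 t + 1 / (sideMotion m q p).r 2 t) := by
      have e0 : Finset.Ioi (0 : Fin 3) = {1, 2} := by decide
      have e1 : Finset.Ioi (1 : Fin 3) = {2} := by decide
      have e2 : Finset.Ioi (2 : Fin 3) = ∅ := by decide
      rw [potential, Fin.sum_univ_three, e0, e1, e2, Finset.sum_pair (by decide),
        Finset.sum_singleton, Finset.sum_empty]
      simp only [hm, sideMotion_r, norm_sub_rev (q t 0) (q t 2)]
      simp
      ring
    have h := hμ t ht
    have hsz : 0 ≤ (sideMotion m q p).size t := Real.sqrt_nonneg _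
    rw [configMeasure, hU, hI, Real.sqrt_mul hM.le, Real.sqrt_sq hsz] at h
    rw [← h]
    have hsM : √M ≠ 0 := (Real.sqrt_pos.2 hM).ne'
    simp only [SideMotion.y]
    field_simp

end

/-! ### Homographic motion from constant normalized sides. -/

theorem theorem6 (m : Fin 3 → ℝ) (hpos : ∀ k, 0 < m k) (hequal : ∀ j k, m j = m k)
    (J : Set ℝ) (q p : ℝ → Fin 3 → Plane) (hsol : IsSolution m J q p)
    (henergy : ∃ t ∈ J, 0 ≤ energy m (q t) (p t))
    (hmeasure : ∃ μ : ℝ, ∀ t ∈ J, configMeasure m (q t) = μ) :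
    IsHomographic J q := by
  obtain ⟨μ, H⟩ := hsol.isNewtonian (fun k => hequal k 0) (hpos 0) hmeasure
  obtain ⟨t₀, ht₀⟩ := hsol.nonempty
  set S := sideMotion m q p with hS
  have hcm : ∀ t ∈ J, ∑ k, q t k = 0 := by
    intro t ht
    have h := hsol.centreOfMass t ht
    simp only [fun k => hequal k 0, ← Finset.smul_sum] at h
    exact (smul_eq_zero.1 h).resolve_left (hpos 0).ne'
  have hr : ∀ t ∈ J, ∀ i, ‖q t (i + 1) - q t (i + 2)‖
      = S.size t / S.size t₀ * ‖q t₀ (i + 1) - q t₀ (i + 2)‖ := by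
    intro t ht i
    have h := H.x_const i t ht t₀ ht₀
    have h1 := (H.size_pos ht).ne'
    have h2 := (H.size_pos ht₀).ne'
    simp only [SideMotion.x] at h
    rw [← sideMotion_r m q p, ← sideMotion_r m q p, ← hS]
    field_simp at h ⊢
    linear_combination h
  -- The condition `t ∈ J` stands inside the existential so that `choose` yields Ω on all of ℝ;
  -- outside `J` the identity serves as a default.
  have key : ∀ t, ∃ Ω : Plane ≃ₗᵢ[ℝ] Plane, t ∈ J →
      ∀ k, q t k = (S.size t / S.size t₀) • Ω (q t₀ k) := by
    intro t
    by_cases ht : t ∈ J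
    · obtain ⟨Ω, hΩ⟩ := exists_isometry_of_proportional
        (div_pos (H.size_pos ht) (H.size_pos ht₀)) (hcm t₀ ht₀) (hcm t ht)
        (hr t ht 2) (hr t ht 0) (hr t ht 1)
      exact ⟨Ω, fun _ => hΩ⟩
    · exact ⟨LinearIsometryEquiv.refl ℝ Plane, fun h => absurd h ht⟩
  choose Ω hΩ using key
  exact ⟨t₀, ht₀, fun t => S.size t / S.size t₀, Ω, fun t ht =>
    ⟨div_pos (H.size_pos ht) (H.size_pos ht₀), hΩ t ht⟩⟩
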